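/- Let $m\ge 1$, $\Lambda>0$ and let $b_0,\dots,b_{2m}$ be real numbers. Put $\Gamma_k=(b_{i+j})_{i,j=0}^{k}$, $\Delta_k=\det\Gamma_k$, $\Delta_{-1}=1$; with $b^1_k=b_{k+1}$ put $\Gamma^{(1)}_{k}=(b_{i+j+1})_{i,j=0}^{k}$, $\Delta^1_k=\det\Gamma^{(1)}_k$, $\Delta^1_{-1}=1$. Assume $\det\Gamma_m>0$ and a) $\Gamma_m\ge 0$; b) for $0\le r\le m-1$ and $\xi_0,\dots,\xi_r\in\mathbb C$, $\sum_{j,k=0}^r b_{j+k}\xi_k\overline{\xi_j}=0$ implies $\sum_{j,k=0}^r b_{j+k+2}\xi_k\overline{\xi_j}=0$; c) $\Gamma^{(1)}_{m-1}\ge 0$, and for $0\le r\le m-1$ and $\xi_0,\dots,\xi_r\in\mathbb C$, $\sum_{j,k=0}^r b_{j+k+1}\xi_k\overline{\xi_j}=0$ implies $\sum_{j,k=0}^r b_{j+k+2}\xi_k\overline{\xi_j}=0$; d) $\Lambda\Gamma_{m-1}-\Gamma^{(1)}_{m-1}\ge 0$. A solution of the truncated Stieltjes (respectively Hausdorff)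 problem is a non-negative measure $\sigma$ concentrated on $[0,\infty)$ (respectively on $[0,\Lambda]$) with $\int t^k\,d\sigma(t)=b_k$ for $0\le k\le 2m$. It is canonical if every element of $L^2_\sigma$ is the class of a polynomial of degree at most $m$. Let $d_0=1/\sqrt{b_0}$ and, for $1\le k\le m$, let $d_k(t)=(\Delta_k\Delta_{k-1})^{-1/2}\det M_k(t)$, where $M_k(t)$ is the $(k+1)\times(k+1)$ matrix with rows $(b_i,b_{i+1},\dots,b_{i+k})$, $0\le i\le k-1$, and last row $(1,t,\dots,t^k)$. Let $d^1_k$ be the analogous polynomials for the sequence $b^1_k$, and let $$e_r(z)=\int\frac{d_r(z)-d_r(t)}{z-t}\,d\sigma(t)$$ for any measure $\sigma$ on $\mathbb R$ with moments $b_0,\dots,b_{2m}$ (the result depends only on the moments). Write $(s_{jk})_{j,k=0}^{m-1}=(\Gamma^{(1)}_{m-1})^{-1}$, $\beta_{m-1}=\sqrt{\Delta_m\Delta_{m-2}}/\Delta_{m-1}$, $$\Lambda_m=-(\Gamma_m^{-1})_{m-1,m}-(\Gamma_m^{-1})_{mm}\sum_{j=0}^{m-1}b_{m+j+1}(\Gamma_m^{-1})_{jm},$$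 $$R_H=(\Gamma_m^{-1})_{mm}^{-1}\Lambda_m-H(\Gamma_m^{-1})_{mm},\qquad H=\tau+\sum_{j,k=0}^{m-1}b_{m+j+1}s_{jk}b_{m+k+1}.$$ Then the formula $$\int_0^\infty\frac{d\sigma(t)}{t-z}=-\frac{e_m(z)(R_H+z)-\beta_{m-1}e_{m-1}(z)}{d_m(z)(R_H+z)-\beta_{m-1}d_{m-1}(z)},\qquad \operatorname{Im}z>0,$$ in which the denominator does not vanish, establishes a bijection between the numbers $\tau\ge 0$ and the canonical solutions $\sigma$ of the truncated Stieltjes problem. The canonical solution with parameter $\tau$ is a canonical solution of the truncated Hausdorff problem on $[0,\Lambda]$ if and only if $d_m(\Lambda)\ne 0$, $\tau\ge 0$ and $$(\Gamma_m^{-1})_{mm}\,\tau\le\Lambda\left(1-\sqrt{\frac{\Delta_m\Delta^1_{m-2}}{\Delta_{m-1}\Delta^1_{m-1}}}\;\frac{d^1_{m-1}(\Lambda)}{d_m(\Lambda)}\right).$$ (Here $(\Gamma_m^{-1})_{mm}=\Delta_{m-1}/\Delta_m$. In particular, there is no such solution if $d_m(\Lambda)=0$ or if the right-hand side is negative.)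 -/

import Mathlib

open MeasureTheory Polynomial

noncomputable section

namespace TruncatedMoment

/-- The `n × n` Hankel matrix `(b_{i+j})_{i,j=0}^{n-1}`. In the usual indexing, `Γ_k` is
`hankel b (k+1)`. -/
def hankel (b : ℕ → ℝ) (n : ℕ) : Matrix (Fin n) (Fin n) ℝ :=
  Matrix.of fun i j => b ((i : ℕ) + (j : ℕ))

/-- The determinant of `hankel b n`. In the usual indexing, `Δ_k` is `hankelDet b (k+1)`; in
particular `Δ_{-1} = hankelDet b 0 = 1`. -/
def hankelDet (b : ℕ → ℝ) (n : ℕ) : ℝ := (hankel b n).det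

/-- The shifted sequence `b^1_k = b_{k+1}`. -/
def shift (b : ℕ → ℝ) : ℕ → ℝ := fun k => b (k + 1)

/-- The sesquilinear Hankel form `∑_{j,k=0}^{r} b_{j+k+s} ξ_k conj ξ_j`. -/
def hankelForm (b : ℕ → ℝ) (s r : ℕ) (ξ : ℕ → ℂ) : ℂ :=
  ∑ j ∈ Finset.range (r + 1), ∑ k ∈ Finset.range (r + 1),
    (b (j + k + s) : ℂ) * ξ k * (starRingEnd ℂ) (ξ j)

/-- a) `Γ_m` is non-negative. -/
def CondA (b : ℕ → ℝ) (m : ℕ) : Prop := (hankel b (m + 1)).PosSemidef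

/-- b) a zero of the form of `Γ_r` is a zero of the form with moments shifted by two. -/
def CondB (b : ℕ → ℝ) (m : ℕ) : Prop :=
  ∀ r < m, ∀ ξ : ℕ → ℂ, hankelForm b 0 r ξ = 0 → hankelForm b 2 r ξ = 0

/-- c) `Γ^{(1)}_{m-1}` is non-negative, and a zero of the form with moments shifted by one is a
zero of the form with moments shifted by two. -/
def CondC (b : ℕ → ℝ) (m : ℕ) : Prop :=
  (hankel (shift b) m).PosSemidef ∧
    ∀ r < m, ∀ ξ : ℕ → ℂ, hankelForm b 1 r ξ = 0 → hankelForm b 2 r ξ = 0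

/-- d) `Λ Γ_{m-1} - Γ^{(1)}_{m-1}` is non-negative. -/
def CondD (b : ℕ → ℝ) (m : ℕ) (Λ : ℝ) : Prop :=
  (Λ • hankel b m - hankel (shift b) m).PosSemidef

/-- `σ` has finite power moments `b_0, …, b_{2m}` on the real axis. -/
def HasMoments (b : ℕ → ℝ) (m : ℕ) (σ : Measure ℝ) : Prop :=
  ∀ k ≤ 2 * m, Integrable (fun t : ℝ => t ^ k) σ ∧ ∫ t, t ^ k ∂σ = b k

/-- `σ` solves the truncated Stieltjes problem: it lives on `[0, ∞)` and has the given moments. -/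
def IsStieltjesSolution (b : ℕ → ℝ) (m : ℕ) (σ : Measure ℝ) : Prop :=
  σ (Set.Ici (0 : ℝ))ᶜ = 0 ∧ HasMoments b m σ

/-- `σ` solves the truncated Hausdorff problem: it lives on `[0, Λ]` and has the given moments. -/
def IsHausdorffSolution (b : ℕ → ℝ) (m : ℕ) (Λ : ℝ) (σ : Measure ℝ) : Prop :=
  σ (Set.Icc (0 : ℝ) Λ)ᶜ = 0 ∧ HasMoments b m σ

/-- `L²(σ) = L_m`: every element of the complex space `L²(σ)` is the class of a polynomial of
degree at most `m`. -/
def IsCanonical (m : ℕ) (σ : Measure ℝ) : Prop :=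
  ∀ f : Lp ℂ 2 σ, ∃ p : ℂ[X], p.natDegree ≤ m ∧ ∀ᵐ t ∂σ, f t = p.eval (t : ℂ)

/-- The orthonormal polynomial `d_k`,
`(Δ_k Δ_{k-1})^{-1/2} det` of the matrix with rows `(b_i, …, b_{i+k})`, `i < k`, and last row
`(1, t, …, t^k)`. For `k = 0` it is the constant `1 / √b_0`. -/
def orthPoly (b : ℕ → ℝ) (k : ℕ) : ℝ[X] :=
  C (1 / Real.sqrt (hankelDet b (k + 1) * hankelDet b k)) *
    (Matrix.of fun i j : Fin (k + 1) =>
      if i = Fin.last k then (X : ℝ[X]) ^ (j : ℕ) else C (b ((i : ℕ) + (j : ℕ)))).det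

/-- `d_k` at a complex argument. -/
def orthEval (b : ℕ → ℝ) (k : ℕ) (z : ℂ) : ℂ := aeval z (orthPoly b k)

/-- The conjugate polynomial `e_r(z) = ∫ (d_r(z) - d_r(t)) / (z - t) dσ(t)`, with the integral of
`(z^k - t^k) / (z - t) = ∑_{i<k} z^i t^{k-1-i}` written through the moments (see
`conjEval_eq_integral`). -/
def conjEval (b : ℕ → ℝ) (r : ℕ) (z : ℂ) : ℂ :=
  ∑ k ∈ Finset.range (r + 1), ((orthPoly b r).coeff k : ℂ) *
    ∑ i ∈ Finset.range k, z ^ i * (b (k - 1 - i) : ℂ)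

theorem natDegree_orthPoly_le (b : ℕ → ℝ) (r : ℕ) : (orthPoly b r).natDegree ≤ r := by
  unfold orthPoly
  refine (natDegree_C_mul_le _ _).trans ?_
  rw [Matrix.det_apply]
  refine natDegree_sum_le_of_forall_le _ _ fun s _ => ?_
  refine (natDegree_smul_le _ _).trans ?_
  refine (natDegree_prod_le _ _).trans ?_
  rw [Finset.sum_eq_single (s.symm (Fin.last r))]
  · simp only [Matrix.of_apply, Equiv.apply_symm_apply, if_true]
    refine (natDegree_X_pow_le _).trans ?_
    omega
  · intro i _ hi
    have : s i ≠ Fin.last r := fun h => hi (by rw [← h, Equiv.symm_apply_apply])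
    simp [this]
  · simp

/-- `conjEval` is the conjugate polynomial computed with any measure having the moments
`b_0, …, b_{2m}`. -/
theorem conjEval_eq_integral (b : ℕ → ℝ) (m r : ℕ) (hr : r ≤ m) (σ : Measure ℝ)
    (hσ : HasMoments b m σ) (z : ℂ) (hz : z.im ≠ 0) :
    conjEval b r z =
      ∫ t : ℝ, (orthEval b r z - orthEval b r (t : ℂ)) / (z - (t : ℂ)) ∂σ := by
  have hint : ∀ k ≤ 2 * m, Integrable (fun t : ℝ => ((t : ℂ)) ^ k) σ := by
    intro k hk
    have := (hσ k hk).1.ofReal (𝕜 := ℂ)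
    simpa using this
  have hval : ∀ k ≤ 2 * m, ∫ t : ℝ, ((t : ℂ)) ^ k ∂σ = (b k : ℂ) := by
    intro k hk
    rw [← (hσ k hk).2, ← integral_complex_ofReal]
    simp
  have key : ∀ t : ℝ, (orthEval b r z - orthEval b r (t : ℂ)) / (z - (t : ℂ)) =
      ∑ k ∈ Finset.range (r + 1), ((orthPoly b r).coeff k : ℂ) *
        ∑ i ∈ Finset.range k, z ^ i * (t : ℂ) ^ (k - 1 - i) := by
    intro t
    have hne : z - (t : ℂ) ≠ 0 := by
      intro h
      apply hz
      have := congrArg Complex.im h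
      simpa using this
    have hlt := Nat.lt_succ_of_le (natDegree_orthPoly_le b r)
    rw [div_eq_iff hne, orthEval, orthEval, aeval_eq_sum_range' hlt, aeval_eq_sum_range' hlt,
      ← Finset.sum_sub_distrib, Finset.sum_mul]
    refine Finset.sum_congr rfl fun k _ => ?_
    rw [mul_assoc, (Commute.all z (t : ℂ)).geom_sum₂_mul]
    simp [mul_sub]
  simp_rw [key]
  rw [integral_finsetSum]
  · unfold conjEval
    refine Finset.sum_congr rfl fun k hk => ?_
    have hk' := Finset.mem_range.1 hk
    rw [integral_const_mul, integral_finsetSum]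
    · congr 1
      refine Finset.sum_congr rfl fun i _ => ?_
      rw [integral_const_mul, hval _ (by omega)]
    · intro i _
      exact (hint _ (by omega)).const_mul _
  · intro k hk
    have hk' := Finset.mem_range.1 hk
    refine Integrable.const_mul ?_ _
    refine integrable_finsetSum _ fun i _ => ?_
    exact (hint _ (by omega)).const_mul _

/-- The entry `(Γ_m⁻¹)_{jm}` of the last column of the inverse of `Γ_m`, for `j ≤ m`. -/
def invEntry (b : ℕ → ℝ) (m j : ℕ) : ℝ :=
  (hankel b (m + 1))⁻¹ (Fin.ofNat (m + 1) j) (Fin.last m)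

/-- `H = τ + ∑_{j,k=0}^{m-1} b_{m+j+1} s_{jk} b_{m+k+1}`, where `(s_{jk})` is the inverse of
`Γ^{(1)}_{m-1} = (b_{j+k+1})_{j,k=0}^{m-1}`. -/
def paramH (b : ℕ → ℝ) (m : ℕ) (τ : ℝ) : ℝ :=
  τ + ∑ j : Fin m, ∑ k : Fin m,
    b (m + j + 1) * (hankel (shift b) m)⁻¹ j k * b (m + k + 1)

/-- `Λ_m = -(Γ_m⁻¹)_{m-1,m} - (Γ_m⁻¹)_{mm} ∑_{j=0}^{m-1} b_{m+j+1} (Γ_m⁻¹)_{jm}`, for `m ≥ 1`. -/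
def lambdaCoeff (b : ℕ → ℝ) (m : ℕ) : ℝ :=
  -invEntry b m (m - 1) -
    invEntry b m m * ∑ j ∈ Finset.range m, b (m + j + 1) * invEntry b m j

/-- `R_H = (Γ_m⁻¹)_{mm}^{-1} Λ_m - H (Γ_m⁻¹)_{mm}`. -/
def paramR (b : ℕ → ℝ) (m : ℕ) (H : ℝ) : ℝ :=
  (invEntry b m m)⁻¹ * lambdaCoeff b m - H * invEntry b m m

/-- `β_{m-1} = √(Δ_m Δ_{m-2}) / Δ_{m-1}`, for `m ≥ 1`. -/
def betaCoeff (b : ℕ → ℝ) (m : ℕ) : ℝ :=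
  Real.sqrt (hankelDet b (m + 1) * hankelDet b (m - 1)) / hankelDet b m

/-- The Nevanlinna-type formula
`∫ dσ(t)/(t-z) = -(e_m(z)(R_H+z) - β_{m-1}e_{m-1}(z)) / (d_m(z)(R_H+z) - β_{m-1}d_{m-1}(z))`
in the upper half-plane (where its denominator does not vanish). -/
def NevanlinnaFormula (b : ℕ → ℝ) (m : ℕ) (H : ℝ) (σ : Measure ℝ) : Prop :=
  ∀ z : ℂ, 0 < z.im →
    orthEval b m z * ((paramR b m H : ℂ) + z) - (betaCoeff b m : ℂ) * orthEval b (m - 1) z ≠ 0 ∧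
    ∫ t : ℝ, 1 / ((t : ℂ) - z) ∂σ =
      -((conjEval b m z * ((paramR b m H : ℂ) + z) -
            (betaCoeff b m : ℂ) * conjEval b (m - 1) z) /
          (orthEval b m z * ((paramR b m H : ℂ) + z) -
            (betaCoeff b m : ℂ) * orthEval b (m - 1) z))

/-- `Λ (1 - √(Δ_m Δ^1_{m-2} / (Δ_{m-1} Δ^1_{m-1})) · d^1_{m-1}(Λ) / d_m(Λ))`, for `m ≥ 1` and
`d_m(Λ) ≠ 0`. -/
def hausdorffBound (b : ℕ → ℝ) (m : ℕ) (Λ : ℝ) : ℝ :=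
  Λ * (1 - Real.sqrt (hankelDet b (m + 1) * hankelDet (shift b) (m - 1) /
        (hankelDet b m * hankelDet (shift b) m)) *
      ((orthPoly (shift b) (m - 1)).eval Λ / (orthPoly b m).eval Λ))

end TruncatedMoment

end

noncomputable section

namespace TruncatedMoment

/-! Since `Γ_m` is positive definite, canonical measures with these moments are exactly the positive
quadrature rules with `m + 1` nodes. Canonicity makes `1/(t - i)` agree almost everywhere with a
polynomial of degree at most `m`, which leaves at most `m + 1` atoms; fewer would give a nonzero
polynomial of degree at most `m` with null square (`IsCanonical.exists_quadrature`).

Such a rule is governed by one number, its moment `H` of order `2m + 1`. The denominator `nevPoly b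
m H` is orthogonal to all polynomials of degree at most `m` (`map_nevPoly_mul`), so it vanishes at
the nodes and is a multiple of their nodal polynomial. The formula is then the partial fraction
expansion of the Stieltjes transform, and it holds for no other `H`, because the denominator depends
injectively on `H` (`IsQuadrature.nevanlinnaFormula_iff`). Nodes and weights are recovered from `H`
(`IsQuadrature.quadMeasure_eq`).

Writing `H` through `τ` turns `τ` into the Schur complement of `Γ^{(1)}_{m-1}` in `Γ^{(1)}_m`. If `τ
≥ 0`, then `Γ^{(1)}_m ≥ 0`, and simultaneous diagonalization of `Γ_m` and `Γ^{(1)}_m` produces a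
rule with non-negative nodes (`exists_canonical_of_posSemidef`). Conversely `τ = ∫ t y² dσ ≥ 0` for
a suitable polynomial `y` (`IsQuadrature.param_nonneg`).

For the Hausdorff problem, the denominator is rewritten with `d_m` and `d^1_{m-1}`
(`IsQuadrature.nevPoly_eq_shift`). Its value at `Λ` shows that `d_m(Λ)` times the slack in the bound
on `τ` is a positive multiple of `∏ (Λ - x)` over the nodes. Condition d) gives `d_m(Λ) ≥ 0` and
allows at most one node beyond `Λ`, so the sign of the product decides
(`IsQuadrature.forall_le_iff`). -/

/-! ### Orthogonal polynomials of a Hankel matrix. -/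

theorem orthPoly_eq_sum (b : ℕ → ℝ) (r : ℕ) :
    orthPoly b r = ∑ j : Fin (r + 1),
      C (1 / Real.sqrt (hankelDet b (r + 1) * hankelDet b r) *
        (hankel b (r + 1)).adjugate j (Fin.last r)) * X ^ (j : ℕ) := by
  unfold orthPoly
  rw [Matrix.det_succ_row _ (Fin.last r), Finset.mul_sum]
  refine Finset.sum_congr rfl fun j _ => ?_
  rw [Matrix.adjugate_fin_succ_eq_det_submatrix]
  have h : ((Matrix.of fun i j : Fin (r + 1) =>
      if i = Fin.last r then (X : ℝ[X]) ^ (j : ℕ) else C (b ((i : ℕ) + (j : ℕ)))).submatrix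
        (Fin.last r).succAbove j.succAbove) =
      (C : ℝ →+* ℝ[X]).mapMatrix
        ((hankel b (r + 1)).submatrix (Fin.last r).succAbove j.succAbove) := by
    ext i k : 2
    simp [hankel, Fin.succAbove_last, Fin.castSucc_ne_last]
  rw [h, ← RingHom.map_det]
  simp only [Matrix.of_apply, if_true, C_mul, C_pow, C_neg, C_1]
  ring

theorem coeff_orthPoly (b : ℕ → ℝ) (r : ℕ) (j : Fin (r + 1)) :
    (orthPoly b r).coeff j = 1 / Real.sqrt (hankelDet b (r + 1) * hankelDet b r) *
        (hankel b (r + 1)).adjugate j (Fin.last r) := by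
  rw [orthPoly_eq_sum, finsetSum_coeff]
  simp only [coeff_C_mul, coeff_X_pow]
  rw [Finset.sum_eq_single j]
  · simp
  · intro i _ hi
    rw [if_neg, mul_zero]
    exact fun h => hi (Fin.ext h.symm)
  · simp

theorem adjugate_hankel_last (b : ℕ → ℝ) (r : ℕ) :
    (hankel b (r + 1)).adjugate (Fin.last r) (Fin.last r) = hankelDet b r := by
  rw [Matrix.adjugate_fin_succ_eq_det_submatrix]
  have h : (hankel b (r + 1)).submatrix (Fin.last r).succAbove (Fin.last r).succAbove =
      hankel b r := by
    ext i j
    simp [hankel, Fin.succAbove_last]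
  rw [h, hankelDet, ← two_mul, pow_mul]
  simp

/-- The leading coefficient of `orthPoly b r`. -/
def leadCoeff (b : ℕ → ℝ) (r : ℕ) : ℝ :=
  hankelDet b r / Real.sqrt (hankelDet b (r + 1) * hankelDet b r)

theorem coeff_orthPoly_self (b : ℕ → ℝ) (r : ℕ) : (orthPoly b r).coeff r = leadCoeff b r := by
  have := coeff_orthPoly b r (Fin.last r)
  rw [adjugate_hankel_last] at this
  rw [Fin.val_last] at this
  rw [this, leadCoeff]
  ring

theorem leadCoeff_pos {b : ℕ → ℝ} {r : ℕ} (h0 : 0 < hankelDet b r)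
    (h1 : 0 < hankelDet b (r + 1)) : 0 < leadCoeff b r := by
  unfold leadCoeff; positivity

theorem leadCoeff_eq_sqrt {b : ℕ → ℝ} {r : ℕ} (h0 : 0 < hankelDet b r)
    (h1 : 0 < hankelDet b (r + 1)) :
    leadCoeff b r = Real.sqrt (hankelDet b r / hankelDet b (r + 1)) := by
  rw [← Real.sqrt_sq (leadCoeff_pos h0 h1).le]
  congr 1
  rw [leadCoeff, div_pow, Real.sq_sqrt (by positivity)]
  field_simp

/-- The coefficients of `orthPoly b r` are, up to scaling, the last column of the adjugate, so the
pairing with `X ^ k` is an entry of the matrix times its adjugate, that is, of the determinant times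
the identity. -/
theorem map_orthPoly_mul_X_pow {b : ℕ → ℝ} {r k : ℕ} (hk : k ≤ r) (L : ℝ[X] →ₗ[ℝ] ℝ)
    (hL : ∀ j ≤ r, L (X ^ (j + k)) = b (j + k)) :
    L (orthPoly b r * X ^ k) = if k = r then
      hankelDet b (r + 1) / Real.sqrt (hankelDet b (r + 1) * hankelDet b r) else 0 := by
  have h := congrFun (congrFun (Matrix.mul_adjugate (hankel b (r + 1))) ⟨k, by omega⟩) (Fin.last r)
  rw [Matrix.mul_apply] at h
  rw [orthPoly_eq_sum, Finset.sum_mul, map_sum]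
  have h2 : ∀ j : Fin (r + 1), L (C (1 / Real.sqrt (hankelDet b (r + 1) * hankelDet b r) *
        (hankel b (r + 1)).adjugate j (Fin.last r)) * X ^ (j : ℕ) * X ^ k) =
      1 / Real.sqrt (hankelDet b (r + 1) * hankelDet b r) *
        (hankel b (r + 1) ⟨k, by omega⟩ j * (hankel b (r + 1)).adjugate j (Fin.last r)) := by
    intro j
    rw [mul_assoc, ← pow_add, ← smul_eq_C_mul, map_smul, hL _ (by omega)]
    simp only [hankel, Matrix.of_apply, smul_eq_mul, add_comm k]
    ring
  rw [Finset.sum_congr rfl fun j _ => h2 j, ← Finset.mul_sum, h]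
  by_cases hkr : k = r
  · subst hkr
    have : (⟨k, by omega⟩ : Fin (k + 1)) = Fin.last k := rfl
    simp [this, hankelDet, div_eq_inv_mul]
  · have : (⟨k, by omega⟩ : Fin (r + 1)) ≠ Fin.last r := fun h => hkr (by simpa using congrArg Fin.val h)
    simp [this, hkr]

/-- Pairing `orthPoly b r` with polynomials of degree at most `r`. -/
theorem map_orthPoly_mul {b : ℕ → ℝ} {r : ℕ} (h0 : 0 < hankelDet b r)
    (h1 : 0 < hankelDet b (r + 1)) (L : ℝ[X] →ₗ[ℝ] ℝ) {p : ℝ[X]} (hp : p.natDegree ≤ r)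
    (hL : ∀ k ≤ r + p.natDegree, L (X ^ k) = b k) :
    L (orthPoly b r * p) = p.coeff r / leadCoeff b r := by
  conv_lhs => rw [p.as_sum_range_C_mul_X_pow' (Nat.lt_succ_self _), Finset.mul_sum, map_sum]
  have key : ∀ k ∈ Finset.range (p.natDegree + 1), L (orthPoly b r * (C (p.coeff k) * X ^ k)) =
      if k = r then p.coeff r / leadCoeff b r else 0 := by
    intro k hk
    have hk' := Finset.mem_range.1 hk
    rw [mul_left_comm, ← smul_eq_C_mul, map_smul,
      map_orthPoly_mul_X_pow (by omega) L fun j hj => hL _ (by omega)]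
    split_ifs with h
    · subst h
      rw [smul_eq_mul, leadCoeff, div_eq_mul_inv (p.coeff k), inv_div]
      congr 1
      have hs := Real.sq_sqrt (show 0 ≤ hankelDet b (k + 1) * hankelDet b k by positivity)
      rw [div_eq_div_iff (by positivity) (by positivity)]
      linarith
    · simp
  rw [Finset.sum_congr rfl key, Finset.sum_ite_eq']
  split_ifs with h
  · rfl
  · rw [coeff_eq_zero_of_natDegree_lt, zero_div]
    simpa using h

/-! ### The denominator as an orthogonal polynomial of degree `m + 1`. -/

/-- The denominator of the Nevanlinna formula. -/
def nevPoly (b : ℕ → ℝ) (m : ℕ) (H : ℝ) : ℝ[X] :=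
  orthPoly b m * (X + C (paramR b m H)) - C (betaCoeff b m) * orthPoly b (m - 1)

theorem natDegree_nevPoly_le (b : ℕ → ℝ) (m : ℕ) (H : ℝ) :
    (nevPoly b m H).natDegree ≤ m + 1 := by
  refine (natDegree_sub_le _ _).trans (max_le ?_ ?_)
  · exact natDegree_mul_le_of_le (natDegree_orthPoly_le b m) (natDegree_X_add_C _).le
  · exact (natDegree_C_mul_le _ _).trans ((natDegree_orthPoly_le b _).trans (by omega))

theorem coeff_orthPoly_of_lt (b : ℕ → ℝ) {r k : ℕ} (h : r < k) : (orthPoly b r).coeff k = 0 :=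
  coeff_eq_zero_of_natDegree_lt ((natDegree_orthPoly_le b r).trans_lt h)

theorem coeff_nevPoly (b : ℕ → ℝ) (m : ℕ) (H : ℝ) :
    (nevPoly b m H).coeff (m + 1) = leadCoeff b m := by
  rw [nevPoly, mul_add, coeff_sub, coeff_add, coeff_mul_X, coeff_mul_C, coeff_C_mul,
    coeff_orthPoly_self, coeff_orthPoly_of_lt b (by omega), coeff_orthPoly_of_lt b (by omega)]
  ring

/-- Both sides are multiples of the same adjugate column. For `j = m` this gives `(Γ_m⁻¹)_{mm} =
κ²`, with `κ` the leading coefficient of `d_m`. -/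
theorem invEntry_eq (b : ℕ → ℝ) {m j : ℕ} (hj : j ≤ m) (h0 : 0 < hankelDet b m)
    (h1 : 0 < hankelDet b (m + 1)) :
    invEntry b m j = leadCoeff b m * (orthPoly b m).coeff j := by
  have h := coeff_orthPoly b m ⟨j, by omega⟩
  have hj' : (Fin.ofNat (m + 1) j) = ⟨j, by omega⟩ :=
    Fin.ext (by simp [Fin.ofNat, Nat.mod_eq_of_lt (show j < m + 1 by omega)])
  simp only at h
  rw [h, invEntry, Matrix.inv_def, hj', leadCoeff, Matrix.smul_apply, Ring.inverse_eq_inv',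
    smul_eq_mul]
  change (hankelDet b (m + 1))⁻¹ * _ = _
  have hs := Real.mul_self_sqrt (show 0 ≤ hankelDet b (m + 1) * hankelDet b m by positivity)
  have hpos : 0 < Real.sqrt (hankelDet b (m + 1) * hankelDet b m) := by positivity
  generalize Real.sqrt (hankelDet b (m + 1) * hankelDet b m) = s at *
  generalize (hankel b (m + 1)).adjugate _ _ = a
  have : (hankelDet b (m + 1))⁻¹ = hankelDet b m / (s * s) := by
    rw [hs]; field_simp
  rw [this]; ring

/-- Identifies `β_{m-1}` as the off-diagonal Jacobi coefficient of the three-term recurrence. -/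
theorem betaCoeff_eq {b : ℕ → ℝ} {m : ℕ} (hm : 1 ≤ m) (hpos : ∀ k ≤ m + 1, 0 < hankelDet b k) :
    betaCoeff b m = leadCoeff b (m - 1) / leadCoeff b m := by
  obtain ⟨n, rfl⟩ : ∃ n, m = n + 1 := ⟨m - 1, by omega⟩
  have h0 := hpos n (by omega)
  have h1 := hpos (n + 1) (by omega)
  have h2 := hpos (n + 1 + 1) (by omega)
  rw [Nat.add_sub_cancel, leadCoeff_eq_sqrt h0 h1, leadCoeff_eq_sqrt h1 h2,
    ← Real.sqrt_div (by positivity), betaCoeff, Nat.add_sub_cancel]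
  rw [← Real.sqrt_sq (show 0 ≤ Real.sqrt (hankelDet b (n + 1 + 1) * hankelDet b n) /
    hankelDet b (n + 1) by positivity)]
  congr 1
  rw [div_pow, Real.sq_sqrt (by positivity)]
  field_simp

theorem natDegree_lt_of_coeff_eq_zero {p : ℝ[X]} {n : ℕ} (hn : 0 < n) (hp : p.natDegree ≤ n)
    (h : p.coeff n = 0) : p.natDegree < n := by
  refine lt_of_le_of_ne hp fun he => ?_
  subst he
  rw [leadingCoeff_eq_zero.1 h, natDegree_zero] at hn
  exact hn.ne rfl

/-- A polynomial annihilating all polynomials of degree `< m` and one of exact degree `m`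
annihilates all polynomials of degree at most `m`. -/
theorem map_mul_eq_zero_of_lt_of_eq {m : ℕ} (hm : 1 ≤ m) (L : ℝ[X] →ₗ[ℝ] ℝ) {P y : ℝ[X]}
    (hP : ∀ p : ℝ[X], p.natDegree < m → L (P * p) = 0) (hy : y.natDegree ≤ m)
    (hy' : y.coeff m ≠ 0) (hPy : L (P * y) = 0) {p : ℝ[X]} (hp : p.natDegree ≤ m) :
    L (P * p) = 0 := by
  have hdeg : (p - C (p.coeff m / y.coeff m) * y).natDegree < m := by
    have hle : (p - C (p.coeff m / y.coeff m) * y).natDegree ≤ m :=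
      (natDegree_sub_le _ _).trans (max_le hp ((natDegree_C_mul_le _ _).trans hy))
    refine natDegree_lt_of_coeff_eq_zero hm hle ?_
    rw [coeff_sub, coeff_C_mul, div_mul_cancel₀ _ hy', sub_self]
  have h := hP _ hdeg
  have h3 : P * p = P * (p - C (p.coeff m / y.coeff m) * y) + (p.coeff m / y.coeff m) • (P * y) := by
    rw [smul_eq_C_mul]; ring
  rw [h3, map_add, map_smul, h, hPy]; simp

/-- This is one step of the three-term recurrence. Below degree `m` the terms `t d_m` and `β_{m-1}
d_{m-1}` cancel; orthogonality to `d_m` itself says that `-R_H` is the diagonal Jacobi coefficient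
`∫ t d_m² dσ`, the only place where the moment of order `2m + 1` enters. -/
theorem map_nevPoly_mul {b : ℕ → ℝ} {m : ℕ} (hm : 1 ≤ m)
    (hpos : ∀ k ≤ m + 1, 0 < hankelDet b k) (L : ℝ[X] →ₗ[ℝ] ℝ)
    (hL : ∀ k ≤ 2 * m, L (X ^ k) = b k) {p : ℝ[X]} (hp : p.natDegree ≤ m) :
    L (nevPoly b m (L (X ^ (2 * m + 1))) * p) = 0 := by
  have h0 := hpos m (by omega)
  have h1 := hpos (m + 1) (by omega)
  have h2 := hpos (m - 1) (by omega)
  have h3 : 0 < hankelDet b (m - 1 + 1) := hpos (m - 1 + 1) (by omega)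
  have hk := leadCoeff_pos h0 h1
  have hk' := leadCoeff_pos h2 h3
  set κ := leadCoeff b m with hκ
  set d := orthPoly b m with hd
  have hdd : d.natDegree ≤ m := natDegree_orthPoly_le b m
  have hdm : d.coeff m = κ := coeff_orthPoly_self b m
  refine map_mul_eq_zero_of_lt_of_eq (y := d) hm L ?_ hdd (by rw [hdm]; exact hk.ne') ?_ hp
  · intro q hq
    have e : nevPoly b m (L (X ^ (2 * m + 1))) * q =
        d * (q * X) + (paramR b m (L (X ^ (2 * m + 1)))) • (d * q) -
          betaCoeff b m • (orthPoly b (m - 1) * q) := by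
      rw [nevPoly, smul_eq_C_mul, smul_eq_C_mul]; ring
    have hqX : (q * X).natDegree ≤ q.natDegree + 1 :=
      natDegree_mul_le_of_le le_rfl natDegree_X_le
    rw [e, map_sub, map_add, map_smul, map_smul,
      map_orthPoly_mul h0 h1 L (p := q * X) (by omega) (fun k hk => hL k (by omega)),
      map_orthPoly_mul h0 h1 L (p := q) (by omega) (fun k hk => hL k (by omega)),
      map_orthPoly_mul h2 h3 L (p := q) (by omega) (fun k hk => hL k (by omega)),
      betaCoeff_eq hm hpos, coeff_eq_zero_of_natDegree_lt hq]
    obtain ⟨n, rfl⟩ : ∃ n, m = n + 1 := ⟨m - 1, by omega⟩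
    rw [coeff_mul_X]
    simp only [Nat.add_sub_cancel, smul_eq_mul] at *
    field_simp
    simp
  -- Removing the leading term from `d * X` leaves degree at most `m`, where orthogonality applies;
  -- the moment of order `2m + 1` then occurs only in `L (d * X ^ (m + 1))`.
  · have e : nevPoly b m (L (X ^ (2 * m + 1))) * d =
        d * (d * X - C κ * X ^ (m + 1)) + κ • (d * X ^ (m + 1)) +
        (paramR b m (L (X ^ (2 * m + 1)))) • (d * d) -
          betaCoeff b m • (d * orthPoly b (m - 1)) := by
      rw [nevPoly, smul_eq_C_mul, smul_eq_C_mul, smul_eq_C_mul]; ring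
    have hdeg : (d * X - C κ * X ^ (m + 1)).natDegree ≤ m := by
      have hle : (d * X - C κ * X ^ (m + 1)).natDegree ≤ m + 1 :=
        (natDegree_sub_le _ _).trans (max_le (natDegree_mul_le_of_le hdd natDegree_X_le)
          (natDegree_C_mul_X_pow_le _ _))
      refine Nat.le_of_lt_succ (natDegree_lt_of_coeff_eq_zero m.succ_pos hle ?_)
      rw [coeff_sub, coeff_mul_X, hdm, coeff_C_mul_X_pow]; simp
    have hlast : L (d * X ^ (m + 1)) = κ * L (X ^ (2 * m + 1)) +
        ∑ j ∈ Finset.range m, d.coeff j * b (m + j + 1) := by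
      conv_lhs => rw [d.as_sum_range_C_mul_X_pow' (Nat.lt_succ_of_le hdd), Finset.sum_mul, map_sum,
        Finset.sum_range_succ, add_comm]
      congr 1
      · rw [mul_assoc, ← pow_add, ← smul_eq_C_mul, map_smul, hdm, smul_eq_mul]
        congr 3; ring
      · refine Finset.sum_congr rfl fun j hj => ?_
        have := Finset.mem_range.1 hj
        rw [mul_assoc, ← pow_add, ← smul_eq_C_mul, map_smul, smul_eq_mul, hL _ (by omega)]
        congr 2; ring
    have hm1 : (orthPoly b (m - 1)).natDegree ≤ m - 1 := natDegree_orthPoly_le b _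
    rw [e, map_sub, map_add, map_add, map_smul, map_smul, map_smul, hlast,
      map_orthPoly_mul h0 h1 L hdeg (fun k hk => hL k (by omega)),
      map_orthPoly_mul h0 h1 L (p := d) hdd (fun k hk => hL k (by omega)),
      map_orthPoly_mul h0 h1 L (p := orthPoly b (m - 1)) (by omega) (fun k hk => hL k (by omega)),
      coeff_orthPoly_of_lt b (show m - 1 < m by omega), ← hκ, hdm]
    have hsum : ∑ j ∈ Finset.range m, b (m + j + 1) * invEntry b m j =
        κ * ∑ j ∈ Finset.range m, d.coeff j * b (m + j + 1) := by
      rw [Finset.mul_sum]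
      refine Finset.sum_congr rfl fun j hj => ?_
      rw [invEntry_eq b (Finset.mem_range.1 hj).le h0 h1, ← hd, ← hκ]; ring
    rw [paramR, lambdaCoeff, hsum, invEntry_eq b le_rfl h0 h1, invEntry_eq b (Nat.sub_le m 1) h0 h1,
      ← hd, ← hκ, hdm]
    obtain ⟨n, rfl⟩ : ∃ n, m = n + 1 := ⟨m - 1, by omega⟩
    rw [coeff_sub, coeff_mul_X, coeff_C_mul_X_pow]
    simp only [Nat.add_sub_cancel, smul_eq_mul]
    rw [if_neg (by omega)]
    field_simp
    ring

/-! ### Positive quadrature rules and their measures. -/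

/-- The functional `p ↦ ∑_{x ∈ S} w x * p(x)`. -/
def quadFun (S : Finset ℝ) (w : ℝ → ℝ) : ℝ[X] →ₗ[ℝ] ℝ := ∑ x ∈ S, w x • Polynomial.leval x

theorem quadFun_apply (S : Finset ℝ) (w : ℝ → ℝ) (p : ℝ[X]) :
    quadFun S w p = ∑ x ∈ S, w x * p.eval x := by
  simp [quadFun, LinearMap.sum_apply, Polynomial.leval_apply]

/-- A positive quadrature rule with `m + 1` nodes and moments `b_0, …, b_{2m}`. -/
structure IsQuadrature (b : ℕ → ℝ) (m : ℕ) (S : Finset ℝ) (w : ℝ → ℝ) : Prop where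
  card : S.card = m + 1
  pos : ∀ x ∈ S, 0 < w x
  moment : ∀ k ≤ 2 * m, quadFun S w (X ^ k) = b k

/-- The measure `∑_{x ∈ S} w x δ_x`. -/
def quadMeasure (S : Finset ℝ) (w : ℝ → ℝ) : Measure ℝ :=
  ∑ x ∈ S, ENNReal.ofReal (w x) • Measure.dirac x

theorem integrable_quadMeasure {E : Type*} [NormedAddCommGroup E] (S : Finset ℝ) (w : ℝ → ℝ)
    (f : ℝ → E) : Integrable f (quadMeasure S w) := by
  refine integrable_finsetSum_measure.2 fun x _ => ?_
  exact (integrable_dirac (by simp)).smul_measure (by simp)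

theorem integral_quadMeasure {E : Type*} [NormedAddCommGroup E] [NormedSpace ℝ E]
    {S : Finset ℝ} {w : ℝ → ℝ} (hw : ∀ x ∈ S, 0 < w x) (f : ℝ → E) [CompleteSpace E] :
    ∫ t, f t ∂(quadMeasure S w) = ∑ x ∈ S, w x • f x := by
  rw [quadMeasure, integral_finsetSum_measure
    (fun x _ => (integrable_dirac (by simp)).smul_measure (by simp))]
  refine Finset.sum_congr rfl fun x hx => ?_
  rw [integral_smul_measure, integral_dirac, ENNReal.toReal_ofReal (hw x hx).le]

theorem quadMeasure_eq_zero_iff {S : Finset ℝ} {w : ℝ → ℝ} (hw : ∀ x ∈ S, 0 < w x)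
    {A : Set ℝ} (hA : MeasurableSet A) : quadMeasure S w A = 0 ↔ ∀ x ∈ S, x ∉ A := by
  simp only [quadMeasure, Measure.finsetSum_apply, Measure.smul_apply, smul_eq_mul,
    Finset.sum_eq_zero_iff, mul_eq_zero, ENNReal.ofReal_eq_zero]
  refine forall₂_congr fun x hx => ?_
  rw [Measure.dirac_apply' _ hA, or_iff_right (not_le.2 (hw x hx))]
  by_cases h : x ∈ A <;> simp [h]

theorem IsQuadrature.hasMoments {b : ℕ → ℝ} {m : ℕ} {S : Finset ℝ} {w : ℝ → ℝ}
    (h : IsQuadrature b m S w) : HasMoments b m (quadMeasure S w) := by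
  intro k hk
  refine ⟨integrable_quadMeasure _ _ _, ?_⟩
  rw [integral_quadMeasure h.pos, ← h.moment k hk, quadFun_apply]
  simp

/-- The nodal polynomial of the remaining nodes isolates the node `x`. With `m + 1` nodes its degree
is `m`, so it is an admissible test polynomial both for locating nodes and for recovering weights.
-/
theorem quadFun_mul_nodal_erase {S : Finset ℝ} (w : ℝ → ℝ) {x : ℝ} (hx : x ∈ S) (P : ℝ[X]) :
    quadFun S w (P * Lagrange.nodal (S.erase x) id) =
      w x * P.eval x * ∏ y ∈ S.erase x, (x - y) := by
  rw [quadFun_apply, Finset.sum_eq_single x]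
  · simp [Lagrange.eval_nodal, mul_assoc]
  · intro y hy hyx
    have : (Lagrange.nodal (S.erase x) id).eval y = 0 :=
      Lagrange.eval_nodal_at_node (v := id) (Finset.mem_erase.2 ⟨hyx, hy⟩)
    rw [eval_mul, this]; simp
  · exact fun h => absurd hx h

theorem prod_erase_sub_ne_zero {S : Finset ℝ} {x : ℝ} : ∏ y ∈ S.erase x, (x - y) ≠ 0 :=
  Finset.prod_ne_zero_iff.2 fun _ hy => sub_ne_zero.2 (Finset.ne_of_mem_erase hy).symm

theorem IsQuadrature.natDegree_nodal_erase {b : ℕ → ℝ} {m : ℕ} {S : Finset ℝ} {w : ℝ → ℝ}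
    (h : IsQuadrature b m S w) {x : ℝ} (hx : x ∈ S) :
    (Lagrange.nodal (S.erase x) id : ℝ[X]).natDegree = m := by
  rw [Lagrange.natDegree_nodal, Finset.card_erase_of_mem hx, h.card, Nat.add_sub_cancel]

theorem IsQuadrature.eval_eq_zero {b : ℕ → ℝ} {m : ℕ} {S : Finset ℝ} {w : ℝ → ℝ}
    (h : IsQuadrature b m S w) {P : ℝ[X]}
    (hP : ∀ p : ℝ[X], p.natDegree ≤ m → quadFun S w (P * p) = 0) {x : ℝ} (hx : x ∈ S) :
    P.eval x = 0 := by
  have h1 := hP _ (h.natDegree_nodal_erase hx).le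
  rw [quadFun_mul_nodal_erase w hx] at h1
  simpa [prod_erase_sub_ne_zero, (h.pos x hx).ne'] using h1

theorem IsQuadrature.eq_C_mul_nodal {b : ℕ → ℝ} {m : ℕ} {S : Finset ℝ} {w : ℝ → ℝ}
    (h : IsQuadrature b m S w) {P : ℝ[X]} (hd : P.natDegree ≤ m + 1)
    (hP : ∀ x ∈ S, P.eval x = 0) : P = C (P.coeff (m + 1)) * Lagrange.nodal S id := by
  have hn : (Lagrange.nodal S id : ℝ[X]).natDegree = m + 1 := by
    rw [Lagrange.natDegree_nodal, h.card]
  refine eq_of_degree_sub_lt_of_eval_finset_eq S ?_ ?_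
  · rw [h.card]
    by_cases h0 : P - C (P.coeff (m + 1)) * Lagrange.nodal S id = 0
    · rw [h0, degree_zero]; exact WithBot.bot_lt_coe _
    rw [← natDegree_lt_iff_degree_lt h0]
    refine natDegree_lt_of_coeff_eq_zero m.succ_pos ?_ ?_
    · exact (natDegree_sub_le _ _).trans (max_le hd ((natDegree_C_mul_le _ _).trans hn.le))
    · have : (Lagrange.nodal S id : ℝ[X]).coeff (m + 1) = 1 := by
        rw [← hn]; exact Lagrange.nodal_monic
      rw [coeff_sub, coeff_C_mul, this, mul_one, sub_self]
  · intro x hx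
    have : (Lagrange.nodal S id : ℝ[X]).eval x = 0 := Lagrange.eval_nodal_at_node (v := id) hx
    rw [hP x hx, eval_mul, this, mul_zero]

theorem IsQuadrature.eval_nevPoly {b : ℕ → ℝ} {m : ℕ} {S : Finset ℝ} {w : ℝ → ℝ}
    (h : IsQuadrature b m S w) (hm : 1 ≤ m) (hpos : ∀ k ≤ m + 1, 0 < hankelDet b k) :
    ∀ x ∈ S, (nevPoly b m (quadFun S w (X ^ (2 * m + 1)))).eval x = 0 :=
  fun _ hx => h.eval_eq_zero (fun _ hp => map_nevPoly_mul hm hpos _ h.moment hp) hx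

theorem IsQuadrature.nevPoly_eq {b : ℕ → ℝ} {m : ℕ} {S : Finset ℝ} {w : ℝ → ℝ}
    (h : IsQuadrature b m S w) {H : ℝ} (hH : ∀ x ∈ S, (nevPoly b m H).eval x = 0) :
    nevPoly b m H = C (leadCoeff b m) * Lagrange.nodal S id := by
  rw [← coeff_nevPoly b m H]
  exact h.eq_C_mul_nodal (natDegree_nevPoly_le b m H) hH

/-- Both denominators equal the same multiple of the nodal polynomial. They differ by a multiple of
`d_m`, and `R_H` is affine in `H` with slope `-κ² ≠ 0`. -/
theorem IsQuadrature.eq_of_eval_nevPoly {b : ℕ → ℝ} {m : ℕ} {S : Finset ℝ} {w : ℝ → ℝ}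
    (h : IsQuadrature b m S w) (hpos : ∀ k ≤ m + 1, 0 < hankelDet b k) {H H' : ℝ}
    (hH : ∀ x ∈ S, (nevPoly b m H).eval x = 0) (hH' : ∀ x ∈ S, (nevPoly b m H').eval x = 0) :
    H = H' := by
  have h0 := hpos m (by omega)
  have h1 := hpos (m + 1) (by omega)
  have hk := leadCoeff_pos h0 h1
  have e := (h.nevPoly_eq hH).trans (h.nevPoly_eq hH').symm
  have e2 : orthPoly b m * C (paramR b m H - paramR b m H') = 0 := by
    rw [nevPoly, nevPoly] at e
    rw [C_sub]; linear_combination e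
  have e3 := congrArg (fun p => coeff p m) e2
  simp only [coeff_mul_C, coeff_orthPoly_self, coeff_zero, mul_eq_zero, hk.ne', false_or] at e3
  rw [paramR, paramR, invEntry_eq b le_rfl h0 h1, coeff_orthPoly_self] at e3
  have e4 : (H - H') * (leadCoeff b m * leadCoeff b m) = 0 := by linarith
  rcases mul_eq_zero.1 e4 with h | h
  · linarith
  · exact absurd h (by positivity)

/-! ### The Nevanlinna formula for quadrature rules. -/

/-- The numerator of the Nevanlinna formula in terms of its denominator. -/
theorem IsQuadrature.nevanlinna_numerator {b : ℕ → ℝ} {m : ℕ} {S : Finset ℝ} {w : ℝ → ℝ}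
    (h : IsQuadrature b m S w) (hm : 1 ≤ m) (hpos : ∀ k ≤ m + 1, 0 < hankelDet b k) (H : ℝ)
    {z : ℂ} (hz : 0 < z.im) :
    conjEval b m z * ((paramR b m H : ℂ) + z) - (betaCoeff b m : ℂ) * conjEval b (m - 1) z =
      aeval z (nevPoly b m H) * ∑ x ∈ S, (w x : ℂ) / (z - x) -
        ∑ x ∈ S, ((w x * (nevPoly b m H).eval x : ℝ) : ℂ) / (z - x) := by
  -- The difference quotient of `z d_m(z)` is `z` times that of `d_m` plus `d_m(t)`; the extra term
  -- has integral zero because `d_m` is orthogonal to constants.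
  have horth : ∑ x ∈ S, (w x : ℂ) * ((orthPoly b m).eval x : ℝ) = 0 := by
    have h2 := map_orthPoly_mul (hpos m (by omega)) (hpos (m + 1) (by omega)) (quadFun S w)
      (p := 1) (by simp) (fun k hk => h.moment k (by simp at hk; omega))
    rw [mul_one, coeff_one, if_neg (by omega), zero_div, quadFun_apply] at h2
    exact_mod_cast congrArg (fun r : ℝ => (r : ℂ)) h2
  have hev : ∀ (p : ℝ[X]) (x : ℝ), aeval (x : ℂ) p = ((p.eval x : ℝ) : ℂ) := fun p x =>
    Polynomial.aeval_algebraMap_apply_eq_algebraMap_eval x p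
  rw [conjEval_eq_integral b m m le_rfl _ h.hasMoments z hz.ne',
    conjEval_eq_integral b m (m - 1) (by omega) _ h.hasMoments z hz.ne',
    integral_quadMeasure h.pos, integral_quadMeasure h.pos, ← sub_eq_zero, Finset.sum_mul,
    Finset.mul_sum, Finset.mul_sum, ← Finset.sum_sub_distrib, ← Finset.sum_sub_distrib,
    ← Finset.sum_sub_distrib, ← neg_eq_zero, ← horth, ← Finset.sum_neg_distrib]
  refine Finset.sum_congr rfl fun x _ => ?_
  have hne : z - (x : ℂ) ≠ 0 := fun h0 => hz.ne' (by simpa using congrArg Complex.im h0)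
  simp only [orthEval, hev, nevPoly, map_sub, map_mul, map_add, aeval_X, aeval_C, eval_sub,
    eval_mul, eval_add, eval_X, eval_C, Complex.real_smul, Complex.coe_algebraMap]
  push_cast
  field_simp
  ring

/-- A rational function with simple poles vanishing in the upper half-plane has no residues. -/
theorem eq_zero_of_sum_div_eq_zero {S : Finset ℝ} {c : ℝ → ℝ}
    (h : ∀ z : ℂ, 0 < z.im → ∑ x ∈ S, (c x : ℂ) / (z - x) = 0) {x : ℝ} (hx : x ∈ S) :
    c x = 0 := by
  classical
  -- The numerator after clearing denominators: it vanishes on a half-plane, hence identically, and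
  -- at `x` only the summand of `x` survives.
  let P : ℂ[X] := ∑ y ∈ S, C (c y : ℂ) * ∏ u ∈ S.erase y, (X - C (u : ℂ))
  have hP : P = 0 := by
    refine eq_zero_of_infinite_isRoot P (Set.Infinite.mono (s := {z : ℂ | 0 < z.im}) ?_ ?_)
    · intro z hz
      have hne : ∀ y : ℝ, z - (y : ℂ) ≠ 0 := fun y h0 =>
        (show 0 < z.im from hz).ne' (by simpa using congrArg Complex.im h0)
      have e : P.eval z = (∏ u ∈ S, (z - u)) * ∑ y ∈ S, (c y : ℂ) / (z - y) := by
        simp only [P, eval_finsetSum, eval_mul, eval_C, eval_prod, eval_sub, eval_X]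
        rw [Finset.mul_sum]
        refine Finset.sum_congr rfl fun y hy => ?_
        rw [← Finset.mul_prod_erase S _ hy]
        field_simp [hne y]
      simp only [Set.mem_ofPred_eq, IsRoot, e, h z hz, mul_zero]
    · refine Set.infinite_of_injective_forall_mem (f := fun n : ℕ => (⟨0, n + 1⟩ : ℂ)) ?_ ?_
      · intro a b hab
        simpa using hab
      · intro n
        simp only [Set.mem_ofPred_eq]; positivity
  have hx0 := congrArg (eval (x : ℂ)) hP
  simp only [P, eval_finsetSum, eval_mul, eval_C, eval_prod, eval_sub, eval_X, eval_zero] at hx0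
  rw [Finset.sum_eq_single x] at hx0
  · rcases mul_eq_zero.1 hx0 with h0 | h0
    · exact_mod_cast h0
    · exfalso
      refine Finset.prod_ne_zero_iff.2 (fun u hu => sub_ne_zero.2 ?_) h0
      exact_mod_cast (Finset.ne_of_mem_erase hu).symm
  · intro y _ hyx
    exact mul_eq_zero_of_right _
      (Finset.prod_eq_zero (i := x) (Finset.mem_erase.2 ⟨hyx.symm, hx⟩) (sub_self _))
  · exact fun h0 => absurd hx h0

/-- A measure given by a quadrature rule satisfies the Nevanlinna formula exactly for the parameter
which is its next moment. -/
theorem IsQuadrature.nevanlinnaFormula_iff {b : ℕ → ℝ} {m : ℕ} {S : Finset ℝ} {w : ℝ → ℝ}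
    (h : IsQuadrature b m S w) (hm : 1 ≤ m) (hpos : ∀ k ≤ m + 1, 0 < hankelDet b k) (H : ℝ) :
    NevanlinnaFormula b m H (quadMeasure S w) ↔ H = quadFun S w (X ^ (2 * m + 1)) := by
  have hden : ∀ (H : ℝ) (z : ℂ), orthEval b m z * ((paramR b m H : ℂ) + z) -
      (betaCoeff b m : ℂ) * orthEval b (m - 1) z = aeval z (nevPoly b m H) := by
    intro H z
    simp only [orthEval, nevPoly, map_sub, map_mul, map_add, aeval_X, aeval_C,
      Complex.coe_algebraMap]
    ring
  have hint : ∀ z : ℂ, ∫ t : ℝ, 1 / ((t : ℂ) - z) ∂(quadMeasure S w) =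
      -∑ x ∈ S, (w x : ℂ) / (z - x) := by
    intro z
    rw [integral_quadMeasure h.pos, ← Finset.sum_neg_distrib]
    refine Finset.sum_congr rfl fun x _ => ?_
    rw [Complex.real_smul, ← neg_sub z (x : ℂ), one_div, inv_neg, div_eq_mul_inv]
    ring
  constructor
  · intro hN
    refine h.eq_of_eval_nevPoly hpos ?_ (h.eval_nevPoly hm hpos)
    intro x hx
    -- Comparing the formula with the numerator identity leaves a vanishing sum of simple fractions
    -- whose residues are the weighted values of the denominator at the nodes.
    have hz := eq_zero_of_sum_div_eq_zero (S := S) (c := fun x => w x * (nevPoly b m H).eval x)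
      (fun z hz => by
        obtain ⟨h1, h2⟩ := hN z hz
        rw [hden] at h1
        rw [hden, hint, h.nevanlinna_numerator hm hpos H hz, neg_inj, eq_div_iff h1] at h2
        linear_combination h2) hx
    simpa [(h.pos x hx).ne'] using hz
  · rintro rfl z hz
    have hv := h.eval_nevPoly hm hpos
    have hne : aeval z (nevPoly b m (quadFun S w (X ^ (2 * m + 1)))) ≠ 0 := by
      rw [h.nevPoly_eq hv, map_mul, aeval_C, Lagrange.nodal, map_prod]
      refine mul_ne_zero ?_ (Finset.prod_ne_zero_iff.2 fun x _ => ?_)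
      · rw [Complex.coe_algebraMap]
        exact_mod_cast (leadCoeff_pos (hpos m (by omega)) (hpos (m + 1) (by omega))).ne'
      · rw [map_sub, aeval_X, aeval_C]
        exact fun h0 => hz.ne' (by simpa using congrArg Complex.im h0)
    rw [hden, hint, h.nevanlinna_numerator hm hpos _ hz]
    refine ⟨hne, ?_⟩
    rw [Finset.sum_eq_zero (s := S)
      (f := fun x => ((w x * (nevPoly b m (quadFun S w (X ^ (2 * m + 1)))).eval x : ℝ) : ℂ) / (z - x))
      (fun x hx => by rw [hv x hx]; simp), sub_zero, mul_div_cancel_left₀ _ hne]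

/-- A quadrature rule is determined by its moments up to the order `2m + 1`. -/
theorem IsQuadrature.quadMeasure_eq {b : ℕ → ℝ} {m : ℕ} {S S' : Finset ℝ} {w w' : ℝ → ℝ}
    (h : IsQuadrature b m S w) (h' : IsQuadrature b m S' w') (hm : 1 ≤ m)
    (hpos : ∀ k ≤ m + 1, 0 < hankelDet b k)
    (hH : quadFun S w (X ^ (2 * m + 1)) = quadFun S' w' (X ^ (2 * m + 1))) :
    quadMeasure S w = quadMeasure S' w' := by
  have hk := leadCoeff_pos (hpos m (by omega)) (hpos (m + 1) (by omega))
  have e := h.nevPoly_eq (h.eval_nevPoly hm hpos)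
  rw [hH, h'.nevPoly_eq (h'.eval_nevPoly hm hpos)] at e
  -- Equal moments of order `2m + 1` give equal denominators, hence equal nodal polynomials and
  -- equal node sets.
  have e2 := mul_left_cancel₀ (C_ne_zero.2 hk.ne') e
  have hS : S = S' := by
    ext x
    have hr : ∀ T : Finset ℝ, x ∈ T ↔ (Lagrange.nodal T id).eval x = 0 := by
      intro T
      rw [Lagrange.eval_nodal, Finset.prod_eq_zero_iff]
      constructor
      · exact fun hx => ⟨x, hx, sub_self _⟩
      · rintro ⟨y, hy, hxy⟩
        rwa [sub_eq_zero.1 hxy]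
    rw [hr, hr, e2]
  subst hS
  refine Finset.sum_congr rfl fun x hx => ?_
  have hL : ∀ p : ℝ[X], p.natDegree ≤ m → quadFun S w p = quadFun S w' p := by
    intro p hp
    rw [p.as_sum_range_C_mul_X_pow' (Nat.lt_succ_of_le hp), map_sum, map_sum]
    refine Finset.sum_congr rfl fun k hk => ?_
    have := Finset.mem_range.1 hk
    rw [← smul_eq_C_mul, map_smul, map_smul, h.moment k (by omega), h'.moment k (by omega)]
  have h2 := hL _ (h.natDegree_nodal_erase hx).le
  rw [← one_mul (Lagrange.nodal (S.erase x) id), quadFun_mul_nodal_erase w hx,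
    quadFun_mul_nodal_erase w' hx, eval_one, mul_one, mul_one] at h2
  rw [mul_right_cancel₀ prod_erase_sub_ne_zero h2]

/-! ### Hankel forms and canonical measures. -/

/-- The Hankel quadratic form in terms of a moment functional. -/
theorem dotProduct_hankel_mulVec {b : ℕ → ℝ} {n : ℕ} (L : ℝ[X] →ₗ[ℝ] ℝ)
    (hL : ∀ k, k + 1 < 2 * n → L (X ^ k) = b k) {p : ℝ[X]} (hp : p.natDegree < n) :
    (fun i : Fin n => p.coeff i) ⬝ᵥ (hankel b n).mulVec (fun i : Fin n => p.coeff i) =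
      L (p * p) := by
  have h : ∀ i j : Fin n, L (C (p.coeff i) * X ^ (i : ℕ) * (C (p.coeff j) * X ^ (j : ℕ))) =
      p.coeff i * (hankel b n i j * p.coeff j) := by
    intro i j
    rw [mul_mul_mul_comm, ← C_mul, ← pow_add, ← smul_eq_C_mul, map_smul, hL _ (by omega)]
    simp only [hankel, Matrix.of_apply, smul_eq_mul]; ring
  conv_rhs => rw [p.as_sum_range_C_mul_X_pow' hp,
    ← Fin.sum_univ_eq_sum_range (fun i => C (p.coeff i) * X ^ i), Finset.sum_mul_sum, map_sum]
  rw [dotProduct]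
  refine Finset.sum_congr rfl fun i _ => ?_
  rw [map_sum, Matrix.mulVec, dotProduct, Finset.mul_sum]
  exact Finset.sum_congr rfl fun j _ => (h i j).symm

theorem map_mul_self_pos {b : ℕ → ℝ} {n : ℕ} (hb : (hankel b n).PosDef) (L : ℝ[X] →ₗ[ℝ] ℝ)
    (hL : ∀ k, k + 1 < 2 * n → L (X ^ k) = b k) {p : ℝ[X]} (hp : p.natDegree < n) (h0 : p ≠ 0) :
    0 < L (p * p) := by
  rw [← dotProduct_hankel_mulVec L hL hp]
  have := hb.dotProduct_mulVec_pos (x := fun i : Fin n => p.coeff i) fun h => h0 ?_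
  · simpa using this
  · refine leadingCoeff_eq_zero.1 ?_
    exact congrFun h ⟨p.natDegree, hp⟩

theorem map_mul_self_nonneg {b : ℕ → ℝ} {n : ℕ} (hb : (hankel b n).PosSemidef)
    (L : ℝ[X] →ₗ[ℝ] ℝ) (hL : ∀ k, k + 1 < 2 * n → L (X ^ k) = b k) {p : ℝ[X]}
    (hp : p.natDegree < n) : 0 ≤ L (p * p) := by
  rw [← dotProduct_hankel_mulVec L hL hp]
  simpa using hb.dotProduct_mulVec_nonneg (fun i : Fin n => p.coeff i)

/-- A measure concentrated on at most `m + 1` points is canonical. -/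
theorem isCanonical_of_ae_mem {m : ℕ} {σ : Measure ℝ} (T : Finset ℝ) (hT : T.card ≤ m + 1)
    (h : ∀ᵐ t ∂σ, t ∈ T) : IsCanonical m σ := by
  intro f
  have hinj : Set.InjOn (fun x : ℝ => (x : ℂ)) T := Complex.ofReal_injective.injOn
  refine ⟨Lagrange.interpolate T (fun x : ℝ => (x : ℂ)) (fun x => f x), ?_, ?_⟩
  · refine natDegree_le_of_degree_le ((Lagrange.degree_interpolate_le _ hinj).trans ?_)
    exact_mod_cast (by omega : T.card - 1 ≤ m)
  · filter_upwards [h] with t ht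
    exact (Lagrange.eval_interpolate_at_node _ hinj ht).symm

theorem HasMoments.isFiniteMeasure {b : ℕ → ℝ} {m : ℕ} {σ : Measure ℝ} (h : HasMoments b m σ) :
    IsFiniteMeasure σ := by
  have := (h 0 (Nat.zero_le _)).1
  simp only [pow_zero] at this
  exact (integrable_const_iff_isFiniteMeasure one_ne_zero).1 this

/-- A canonical measure is concentrated on at most `m + 1` points. -/
theorem IsCanonical.exists_finset {m : ℕ} {σ : Measure ℝ} [IsFiniteMeasure σ]
    (h : IsCanonical m σ) : ∃ T : Finset ℝ, T.card ≤ m + 1 ∧ ∀ᵐ t ∂σ, t ∈ T := by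
  have hne : ∀ t : ℝ, (t : ℂ) - Complex.I ≠ 0 := fun t h0 => by
    simpa using congrArg Complex.im h0
  -- A bounded function that is not a polynomial: agreement with `p` means `(t - i) p(t) - 1 = 0`,
  -- and this polynomial is nonzero since its value at `i` is `-1`.
  have hf : MemLp (fun t : ℝ => ((t : ℂ) - Complex.I)⁻¹) 2 σ := by
    refine MemLp.of_bound ?_ 1 (Filter.Eventually.of_forall fun t => ?_)
    · exact (Continuous.inv₀ (by fun_prop) hne).aestronglyMeasurable
    · rw [norm_inv]
      refine inv_le_one_of_one_le₀ ?_
      refine le_trans ?_ (Complex.abs_im_le_norm _)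
      simp
  obtain ⟨p, hp, hpe⟩ := h hf.toLp
  let P : ℂ[X] := (X - C Complex.I) * p - 1
  have hP0 : P ≠ 0 := fun h0 => by
    have := congrArg (eval Complex.I) h0
    simp [P] at this
  have hPd : P.natDegree ≤ m + 1 := by
    refine (natDegree_sub_le _ _).trans (max_le ?_ (by simp))
    refine (natDegree_mul_le_of_le (natDegree_X_sub_C _).le hp).trans (by omega)
  refine ⟨P.roots.toFinset.image Complex.re, ?_, ?_⟩
  · exact Finset.card_image_le.trans ((Multiset.toFinset_card_le _).trans
      ((card_roots' P).trans hPd))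
  · filter_upwards [hpe, hf.coeFn_toLp] with t h1 h2
    rw [h2] at h1
    refine Finset.mem_image.2 ⟨t, ?_, Complex.ofReal_re t⟩
    rw [Multiset.mem_toFinset, mem_roots hP0]
    simp [P, ← h1, hne t]

/-- A canonical solution of the moment problem is given by a positive quadrature rule. -/
theorem IsCanonical.exists_quadrature {b : ℕ → ℝ} {m : ℕ} {σ : Measure ℝ}
    (hb : (hankel b (m + 1)).PosDef) (hσ : HasMoments b m σ) (h : IsCanonical m σ) :
    ∃ S w, IsQuadrature b m S w ∧ σ = quadMeasure S w := by
  classical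
  have := hσ.isFiniteMeasure
  obtain ⟨T, hT, hae⟩ := h.exists_finset
  -- Points of zero mass are discarded so that all weights are positive.
  let S := T.filter fun x => σ {x} ≠ 0
  let w : ℝ → ℝ := fun x => (σ {x}).toReal
  have hw : ∀ x ∈ S, 0 < w x := fun x hx =>
    ENNReal.toReal_pos (Finset.mem_filter.1 hx).2 (measure_ne_top _ _)
  have hσe : σ = quadMeasure S w := by
    ext A hA
    have h1 : σ A = σ ((T.filter fun x => x ∈ A : Finset ℝ) : Set ℝ) := by
      refine measure_congr ?_
      filter_upwards [hae] with t ht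
      refine propext ?_
      change t ∈ A ↔ t ∈ ((T.filter fun x => x ∈ A : Finset ℝ) : Set ℝ)
      simp [ht]
    rw [h1, ← sum_measure_singleton, quadMeasure, Measure.finsetSum_apply, Finset.sum_filter,
      Finset.sum_filter]
    refine Finset.sum_congr rfl fun x _ => ?_
    rw [Measure.smul_apply, Measure.dirac_apply' _ hA, ENNReal.ofReal_toReal (measure_ne_top _ _)]
    by_cases hx : x ∈ A <;> by_cases hx' : σ {x} = 0 <;> simp [hx, hx']
  have hmom : ∀ k ≤ 2 * m, quadFun S w (X ^ k) = b k := by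
    intro k hk
    have := (hσ k hk).2
    rw [hσe, integral_quadMeasure hw] at this
    rw [← this, quadFun_apply]
    simp
  refine ⟨S, w, ⟨?_, hw, hmom⟩, hσe⟩
  refine le_antisymm ((Finset.card_filter_le _ _).trans hT) ?_
  -- With too few nodes the nodal polynomial has degree at most `m`, yet its square has integral
  -- zero, against positive definiteness.
  by_contra! hlt
  have hpos := map_mul_self_pos hb (quadFun S w) (fun k hk => hmom k (by omega))
    (p := Lagrange.nodal S id) (by rwa [Lagrange.natDegree_nodal]) Lagrange.nodal_ne_zero
  rw [quadFun_apply, Finset.sum_eq_zero] at hpos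
  · exact hpos.ne rfl
  · intro x hx
    have : (Lagrange.nodal S id : ℝ[X]).eval x = 0 := Lagrange.eval_nodal_at_node (v := id) hx
    rw [eval_mul, this]; simp

/-! ### Positivity of the shifted Hankel matrices and the Schur complement. -/

/-- The functional on polynomials with moments `b`. -/
def momentFun (b : ℕ → ℝ) : ℝ[X] →ₗ[ℝ] ℝ := Polynomial.lsum fun k => b k • LinearMap.id

theorem momentFun_X_pow (b : ℕ → ℝ) (k : ℕ) : momentFun b (X ^ k) = b k := by
  rw [momentFun, Polynomial.lsum_apply, ← monomial_one_right_eq_X_pow, sum_monomial_index] <;> simp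

/-- The functional `p ↦ L (q * p)`. -/
def mulFun (L : ℝ[X] →ₗ[ℝ] ℝ) (q : ℝ[X]) : ℝ[X] →ₗ[ℝ] ℝ := L ∘ₗ LinearMap.mulLeft ℝ q

theorem mulFun_apply (L : ℝ[X] →ₗ[ℝ] ℝ) (q p : ℝ[X]) : mulFun L q p = L (q * p) := rfl

theorem exists_coeff_eq {n : ℕ} (hn : 0 < n) (v : Fin n → ℝ) :
    ∃ p : ℝ[X], p.natDegree < n ∧ (fun i : Fin n => p.coeff i) = v := by
  refine ⟨∑ i : Fin n, C (v i) * X ^ (i : ℕ), ?_, ?_⟩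
  · refine Nat.lt_of_le_pred hn (natDegree_sum_le_of_forall_le _ _ fun i _ => ?_)
    exact (natDegree_C_mul_X_pow_le _ _).trans (Nat.le_pred_of_lt i.2)
  · funext i
    rw [finsetSum_coeff, Finset.sum_eq_single i]
    · simp
    · intro j _ hj
      rw [coeff_C_mul_X_pow, if_neg fun h => hj (Fin.ext h.symm)]
    · simp

theorem hankel_transpose (b : ℕ → ℝ) (n : ℕ) : (hankel b n).transpose = hankel b n := by
  ext i j
  simp [hankel, add_comm]

theorem hankel_isHermitian (b : ℕ → ℝ) (n : ℕ) : (hankel b n).IsHermitian := by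
  rw [Matrix.IsHermitian, Matrix.conjTranspose_eq_transpose_of_trivial, hankel_transpose]

theorem posSemidef_hankel {b : ℕ → ℝ} {n : ℕ} (hn : 0 < n) (L : ℝ[X] →ₗ[ℝ] ℝ)
    (hL : ∀ k, k + 1 < 2 * n → L (X ^ k) = b k)
    (h : ∀ p : ℝ[X], p.natDegree < n → 0 ≤ L (p * p)) : (hankel b n).PosSemidef := by
  refine .of_dotProduct_mulVec_nonneg (hankel_isHermitian b n) fun v => ?_
  obtain ⟨p, hp, rfl⟩ := exists_coeff_eq hn v
  rw [star_trivial, dotProduct_hankel_mulVec L hL hp]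
  exact h p hp

theorem posDef_hankel {b : ℕ → ℝ} {n : ℕ} (hn : 0 < n) (L : ℝ[X] →ₗ[ℝ] ℝ)
    (hL : ∀ k, k + 1 < 2 * n → L (X ^ k) = b k)
    (h : ∀ p : ℝ[X], p.natDegree < n → p ≠ 0 → 0 < L (p * p)) : (hankel b n).PosDef := by
  refine .of_dotProduct_mulVec_pos (hankel_isHermitian b n) fun v hv => ?_
  obtain ⟨p, hp, rfl⟩ := exists_coeff_eq hn v
  rw [star_trivial, dotProduct_hankel_mulVec L hL hp]
  exact h p hp fun h0 => hv (by subst h0; rfl)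

theorem hankelDet_pos {b : ℕ → ℝ} {n k : ℕ} (h : (hankel b n).PosDef) (hk : k ≤ n) :
    0 < hankelDet b k := by
  have h2 := (h.submatrix (Fin.castLE_injective hk)).det_pos
  exact h2

theorem hankelForm_eq (b : ℕ → ℝ) (s r : ℕ) {p : ℝ[X]} (hp : p.natDegree ≤ r) :
    hankelForm b s r (fun k => (p.coeff k : ℂ)) = (momentFun b (X ^ s * (p * p)) : ℝ) := by
  conv_rhs => rw [p.as_sum_range_C_mul_X_pow' (Nat.lt_succ_of_le hp), Finset.sum_mul_sum,
    Finset.mul_sum, map_sum]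
  rw [hankelForm, Complex.ofReal_sum]
  refine Finset.sum_congr rfl fun j _ => ?_
  rw [Finset.mul_sum, map_sum, Complex.ofReal_sum]
  refine Finset.sum_congr rfl fun k _ => ?_
  have e : X ^ s * (C (p.coeff j) * X ^ j * (C (p.coeff k) * X ^ k)) =
      (p.coeff j * p.coeff k) • (X ^ (j + k + s) : ℝ[X]) := by
    rw [smul_eq_C_mul, C_mul]; ring
  rw [e, map_smul, momentFun_X_pow, Complex.conj_ofReal, smul_eq_mul]
  push_cast; ring

/-- If `L (X * p²) = 0`, the implication in c) gives `L (X² * p²) = 0`. This is the form of `Γ_m` at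
`X * p`, of degree at most `m`, so `p = 0`. -/
theorem CondC.posDef {b : ℕ → ℝ} {m : ℕ} (hm : 1 ≤ m) (hc : CondC b m)
    (hb : (hankel b (m + 1)).PosDef) : (hankel (shift b) m).PosDef := by
  have hL : ∀ k, k + 1 < 2 * m → mulFun (momentFun b) X (X ^ k) = shift b k := fun k _ => by
    rw [mulFun_apply, ← pow_succ', momentFun_X_pow]; rfl
  refine posDef_hankel hm _ hL fun p hp h0 => ?_
  refine lt_of_le_of_ne (map_mul_self_nonneg hc.1 _ hL hp) fun h => ?_
  rw [mulFun_apply] at h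
  have h1 : hankelForm b 1 (m - 1) (fun k => (p.coeff k : ℂ)) = 0 := by
    rw [hankelForm_eq b 1 _ (by omega), pow_one, ← h, Complex.ofReal_zero]
  have h2 := hc.2 (m - 1) (by omega) _ h1
  rw [hankelForm_eq b 2 _ (by omega), Complex.ofReal_eq_zero] at h2
  have h3 := map_mul_self_pos hb (momentFun b) (fun k _ => momentFun_X_pow b k) (p := X * p)
    (by rw [natDegree_X_mul h0]; omega) (mul_ne_zero X_ne_zero h0)
  rw [show X * p * (X * p) = X ^ 2 * (p * p) by ring, h2] at h3
  exact h3.ne rfl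

/-- The monic polynomial `y` of degree `m` orthogonal to lower degrees for the shifted moments. -/
theorem exists_schurPoly {b : ℕ → ℝ} {m : ℕ} (hb : (hankel (shift b) m).PosDef) :
    ∃ y : ℝ[X], y.natDegree ≤ m ∧ y.coeff m = 1 ∧ ∀ L : ℝ[X] →ₗ[ℝ] ℝ,
      (∀ k ≤ 2 * m, L (X ^ k) = b k) → (∀ q : ℝ[X], q.natDegree < m → L (X * y * q) = 0) ∧
        L (X ^ (2 * m + 1)) = paramH b m (L (X * y * X ^ m)) := by
  let g : Fin m → ℝ := fun k => b (m + k + 1)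
  -- Solution of the normal equations: `X ^ m - ∑ s_i X ^ i` is orthogonal to lower degrees for the
  -- shifted moments. Its pairing with `X ^ m` is the Schur complement, which is `τ` when the moment
  -- of order `2m + 1` is `H`.
  let s : Fin m → ℝ := (hankel (shift b) m)⁻¹.mulVec g
  have hs : (hankel (shift b) m).mulVec s = g := by
    rw [Matrix.mulVec_mulVec, Matrix.mul_nonsing_inv _ (isUnit_iff_ne_zero.2 hb.det_pos.ne'),
      Matrix.one_mulVec]
  have hdeg : ∀ k, m ≤ k → (∑ i : Fin m, C (s i) * X ^ (i : ℕ) : ℝ[X]).coeff k = 0 := by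
    intro k hk
    rw [finsetSum_coeff]
    refine Finset.sum_eq_zero fun i _ => ?_
    rw [coeff_C_mul_X_pow, if_neg (by omega)]
  have hexp : ∀ (L : ℝ[X] →ₗ[ℝ] ℝ) (j : ℕ),
      L (X * (X ^ m - ∑ i : Fin m, C (s i) * X ^ (i : ℕ)) * X ^ j) =
        L (X ^ (m + 1 + j)) - ∑ i : Fin m, s i * L (X ^ ((i : ℕ) + 1 + j)) := by
    intro L j
    have e : X * (X ^ m - ∑ i : Fin m, C (s i) * X ^ (i : ℕ)) * X ^ j =
        X ^ (m + 1 + j) - ∑ i : Fin m, s i • (X ^ ((i : ℕ) + 1 + j) : ℝ[X]) := by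
      rw [mul_sub, sub_mul, Finset.mul_sum, Finset.sum_mul]
      congr 1
      · ring
      · refine Finset.sum_congr rfl fun i _ => ?_
        rw [smul_eq_C_mul]; ring
    rw [e, map_sub, map_sum]
    simp
  refine ⟨X ^ m - ∑ i : Fin m, C (s i) * X ^ (i : ℕ), ?_, ?_, fun L hL => ⟨fun q hq => ?_, ?_⟩⟩
  · refine natDegree_le_iff_coeff_eq_zero.2 fun k hk => ?_
    rw [coeff_sub, hdeg k hk.le, coeff_X_pow, if_neg (by omega), sub_zero]
  · rw [coeff_sub, hdeg m le_rfl, coeff_X_pow, if_pos rfl, sub_zero]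
  · conv_lhs => rw [q.as_sum_range_C_mul_X_pow' hq, Finset.mul_sum, map_sum]
    refine Finset.sum_eq_zero fun j hj => ?_
    have hj' := Finset.mem_range.1 hj
    rw [mul_left_comm, ← smul_eq_C_mul, map_smul, hexp, hL _ (by omega)]
    have h := congrFun hs ⟨j, hj'⟩
    simp only [Matrix.mulVec, dotProduct, hankel, shift, Matrix.of_apply, g] at h
    rw [show m + 1 + j = m + j + 1 by ring, ← h, sub_eq_zero.2, smul_zero]
    refine Finset.sum_congr rfl fun i _ => ?_
    rw [hL _ (by omega), show (i : ℕ) + 1 + j = j + i + 1 by ring]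
    ring
  · rw [hexp, paramH, show m + 1 + m = 2 * m + 1 by ring]
    have : ∑ i : Fin m, s i * L (X ^ ((i : ℕ) + 1 + m)) = ∑ j : Fin m, ∑ k : Fin m,
        b (m + j + 1) * (hankel (shift b) m)⁻¹ j k * b (m + k + 1) := by
      refine Finset.sum_congr rfl fun i _ => ?_
      rw [hL _ (by omega), show (i : ℕ) + 1 + m = m + i + 1 by ring]
      simp only [s, Matrix.mulVec, dotProduct, Finset.sum_mul, g]
      refine Finset.sum_congr rfl fun k _ => ?_
      ring
    rw [this]; ring

/-- Completing the square: with `p = q + c y`, `deg q < m` and `y` the orthogonal polynomial of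
`exists_schurPoly`, the form is `L (X * p²) = L (X * q²) + c² τ`. -/
theorem posSemidef_shift_update {b : ℕ → ℝ} {m : ℕ} (hm : 1 ≤ m)
    (hb : (hankel (shift b) m).PosDef) {τ : ℝ} (hτ : 0 ≤ τ) :
    (hankel (shift (Function.update b (2 * m + 1) (paramH b m τ))) (m + 1)).PosSemidef := by
  obtain ⟨y, hy, hy1, hyL⟩ := exists_schurPoly hb
  set b' := Function.update b (2 * m + 1) (paramH b m τ)
  have hb' : ∀ k ≤ 2 * m, momentFun b' (X ^ k) = b k := fun k hk => by
    rw [momentFun_X_pow]; exact Function.update_of_ne (by omega) _ _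
  obtain ⟨h1, h2⟩ := hyL (momentFun b') hb'
  rw [momentFun_X_pow] at h2
  have h3 : paramH b m τ = paramH b m (momentFun b' (X * y * X ^ m)) := by
    rw [← h2]; simp [b']
  have h4 : momentFun b' (X * y * X ^ m) = τ := by
    simp only [paramH] at h3; linarith
  refine posSemidef_hankel (by omega) (mulFun (momentFun b') X)
    (fun k _ => by rw [mulFun_apply, ← pow_succ', momentFun_X_pow]; rfl) fun p hp => ?_
  rw [mulFun_apply]
  have hq : ∀ p : ℝ[X], p.natDegree ≤ m → (p - C (p.coeff m) * y).natDegree < m := fun p hp => by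
    refine natDegree_lt_of_coeff_eq_zero hm ?_ ?_
    · exact (natDegree_sub_le _ _).trans (max_le (by omega) ((natDegree_C_mul_le _ _).trans hy))
    · rw [coeff_sub, coeff_C_mul, hy1, mul_one, sub_self]
  have hyy : momentFun b' (X * y * y) = τ := by
    have h5 := h1 _ (hq (X ^ m) (natDegree_X_pow_le m))
    rw [coeff_X_pow, if_pos rfl, C_1, one_mul, mul_sub, map_sub, h4] at h5
    linarith
  set q := p - C (p.coeff m) * y with hqdef
  have hqd : q.natDegree < m := hq p (by omega)
  have e : X * (p * p) = X * (q * q) + (2 * p.coeff m) • (X * y * q) +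
      (p.coeff m * p.coeff m) • (X * y * y) := by
    have hpq : p = q + C (p.coeff m) * y := by rw [hqdef]; ring
    simp only [smul_eq_C_mul, C_mul]
    conv_lhs => rw [hpq]
    rw [C_ofNat]
    ring
  have hqq : 0 ≤ mulFun (momentFun b') X (q * q) :=
    map_mul_self_nonneg hb.posSemidef _ (fun k hk => by
      rw [mulFun_apply, ← pow_succ', hb' _ (by omega)]; rfl) hqd
  rw [mulFun_apply] at hqq
  rw [e, map_add, map_add, map_smul, map_smul, h1 q hqd, hyy, smul_zero, add_zero, smul_eq_mul]
  have := mul_nonneg (mul_self_nonneg (p.coeff m)) hτ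
  linarith

/-! ### Construction of a canonical solution by simultaneous diagonalization. -/

open Matrix in
open scoped MatrixOrder in
/-- Simultaneous diagonalization of a positive definite and a positive semidefinite form. -/
theorem exists_simultaneous_diagonalization {n : Type*} [Fintype n] [DecidableEq n]
    {A B : Matrix n n ℝ} (hA : A.PosDef) (hB : B.PosSemidef) :
    ∃ (W : Matrix n n ℝ) (x : n → ℝ), (∀ i, 0 ≤ x i) ∧ IsUnit W.det ∧
      A = Wᵀ * W ∧ B = Wᵀ * Matrix.diagonal x * W := by
  -- Factor `A = Vᵀ V`, diagonalize `V⁻ᵀ B V⁻¹ = U D Uᵀ` orthogonally and take `W = Uᵀ V`.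
  obtain ⟨V, hV⟩ := CStarAlgebra.nonneg_iff_eq_star_mul_self.1 hA.posSemidef.nonneg
  rw [Matrix.star_eq_conjTranspose, Matrix.conjTranspose_eq_transpose_of_trivial] at hV
  have hdet : IsUnit V.det := by
    have := hA.det_pos
    rw [hV, Matrix.det_mul] at this
    exact isUnit_iff_ne_zero.2 (right_ne_zero_of_mul this.ne')
  have hC : (V⁻¹ᵀ * B * V⁻¹).PosSemidef := by
    have := hB.conjTranspose_mul_mul_same V⁻¹
    rwa [Matrix.conjTranspose_eq_transpose_of_trivial] at this
  have hsp := hC.1.spectral_theorem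
  rw [Unitary.conjStarAlgAut_apply] at hsp
  set U : Matrix n n ℝ := (hC.1.eigenvectorUnitary : Matrix n n ℝ) with hU
  have hstar : star U = Uᵀ := by
    rw [Matrix.star_eq_conjTranspose, Matrix.conjTranspose_eq_transpose_of_trivial]
  have hUU : U * Uᵀ = 1 := by
    rw [← hstar]; exact Unitary.coe_mul_star_self hC.1.eigenvectorUnitary
  have hsp' : V⁻¹ᵀ * B * V⁻¹ = U * Matrix.diagonal hC.1.eigenvalues * Uᵀ := by
    rw [← hstar]; exact hsp
  refine ⟨Uᵀ * V, hC.1.eigenvalues, hC.eigenvalues_nonneg, ?_, ?_, ?_⟩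
  · rw [Matrix.det_mul]
    refine IsUnit.mul ?_ hdet
    have := congrArg Matrix.det hUU
    rw [Matrix.det_mul, Matrix.det_one] at this
    exact isUnit_iff_ne_zero.2 (right_ne_zero_of_mul (by rw [this]; exact one_ne_zero))
  · rw [Matrix.transpose_mul, Matrix.transpose_transpose, Matrix.mul_assoc, ← Matrix.mul_assoc U,
      hUU, Matrix.one_mul, hV]
  · have hVV : V⁻¹ * V = 1 := Matrix.nonsing_inv_mul V hdet
    have hVT : Vᵀ * V⁻¹ᵀ = 1 := by rw [← Matrix.transpose_mul, hVV, Matrix.transpose_one]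
    calc B = (Vᵀ * V⁻¹ᵀ) * B * (V⁻¹ * V) := by rw [hVV, hVT, Matrix.one_mul, Matrix.mul_one]
      _ = Vᵀ * (V⁻¹ᵀ * B * V⁻¹) * V := by simp only [Matrix.mul_assoc]
      _ = Vᵀ * (U * Matrix.diagonal hC.1.eigenvalues * Uᵀ) * V :=
        congrArg (fun M => Vᵀ * M * V) hsp'
      _ = _ := by
        rw [Matrix.transpose_mul, Matrix.transpose_transpose]
        simp only [Matrix.mul_assoc]

open Matrix in
/-- Positivity of `Γ_m` and of `Γ^{(1)}_m` gives a canonical solution on the half-line with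
prescribed moments `b_0, …, b_{2m+1}`. -/
theorem exists_canonical_of_posSemidef {b : ℕ → ℝ} {m : ℕ} (hA : (hankel b (m + 1)).PosDef)
    (hB : (hankel (shift b) (m + 1)).PosSemidef) :
    ∃ S w, IsQuadrature b m S w ∧ (∀ x ∈ S, 0 ≤ x) ∧ IsCanonical m (quadMeasure S w) ∧
      quadFun S w (X ^ (2 * m + 1)) = b (2 * m + 1) := by
  classical
  obtain ⟨W, x, hx, hdet, hAW, hBW⟩ := exists_simultaneous_diagonalization hA hB
  -- By the Hankel structure, column `k + 1` of `Γ_m` is column `k` of `Γ^{(1)}_m`. Cancelling `Wᵀ`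
  -- shows that column `k + 1` of `W` is `diagonal x` applied to column `k`, so `W` is a Vandermonde
  -- matrix with scaled rows.
  have hcol : ∀ k : ℕ, ∀ hk : k < m + 1, ∀ i, W i ⟨k, hk⟩ = x i ^ k * W i 0 := by
    intro k
    induction k with
    | zero => intro hk i; simp
    | succ k ih =>
      intro hk i
      have h1 : (Wᵀ * W).col ⟨k + 1, hk⟩ = (Wᵀ * Matrix.diagonal x * W).col ⟨k, by omega⟩ := by
        rw [← hAW, ← hBW]
        funext j
        simp only [Matrix.col_apply, hankel, shift, Matrix.of_apply]
        rfl
      have h2 : Wᵀ.mulVec (W.col ⟨k + 1, hk⟩) =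
          Wᵀ.mulVec ((Matrix.diagonal x * W).col ⟨k, by omega⟩) := by
        rw [Matrix.mul_assoc] at h1
        exact h1
      have h3 := Matrix.mulVec_injective_of_isUnit
        ((Matrix.isUnit_iff_isUnit_det _).2 (by rwa [Matrix.det_transpose])) h2
      have h4 := congrFun h3 i
      simp only [Matrix.col_apply, Matrix.diagonal_mul] at h4
      rw [h4, ih]
      ring
  let σ : Measure ℝ := ∑ i : Fin (m + 1), ENNReal.ofReal (W i 0 ^ 2) • Measure.dirac (x i)
  have hint : ∀ k, Integrable (fun t : ℝ => t ^ k) σ := fun k =>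
    integrable_finsetSum_measure.2 fun i _ =>
      (integrable_dirac (by simp)).smul_measure (by simp)
  have hval : ∀ k, ∫ t, t ^ k ∂σ = ∑ i, W i 0 ^ 2 * x i ^ k := by
    intro k
    rw [integral_finsetSum_measure
      (fun x _ => (integrable_dirac (by simp)).smul_measure (by simp))]
    refine Finset.sum_congr rfl fun i _ => ?_
    rw [integral_smul_measure, integral_dirac, ENNReal.toReal_ofReal (sq_nonneg _), smul_eq_mul]
  have hmom : HasMoments b m σ := by
    intro k hk
    refine ⟨hint k, ?_⟩
    -- Every order up to `2m` is a sum of two indices at most `m`, hence is read off from an entry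
    -- of `Γ_m`.
    have h := congrFun (congrFun hAW ⟨min k m, by omega⟩) ⟨k - min k m, by omega⟩
    simp only [hankel, Matrix.of_apply, Matrix.mul_apply, Matrix.transpose_apply,
      hcol (min k m) (by omega), hcol (k - min k m) (by omega)] at h
    rw [show min k m + (k - min k m) = k by omega] at h
    rw [hval, h]
    refine Finset.sum_congr rfl fun i _ => ?_
    have : x i ^ k = x i ^ (min k m) * x i ^ (k - min k m) := by
      rw [← pow_add]; congr 1; omega
    rw [this]; ring
  have hae : ∀ᵐ t ∂σ, t ∈ Finset.univ.image x := by
    refine ae_iff.2 ?_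
    simp only [σ, Measure.finsetSum_apply, Measure.smul_apply, smul_eq_mul]
    refine Finset.sum_eq_zero fun i _ => ?_
    rw [Measure.dirac_apply]
    simp
  have hcan : IsCanonical m σ := isCanonical_of_ae_mem _
    (Finset.card_image_le.trans (by simp)) hae
  -- Passing through canonicity avoids checking directly that the `x i` are distinct and the weights
  -- `W i 0 ^ 2` nonzero.
  obtain ⟨S, w, hS, hσ⟩ := hcan.exists_quadrature hA hmom
  refine ⟨S, w, hS, fun t ht => ?_, hσ ▸ hcan, ?_⟩
  · have h0 : quadMeasure S w {t | 0 ≤ t}ᶜ = 0 := by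
      rw [← hσ]
      have hae' : ∀ᵐ u ∂σ, 0 ≤ u := by
        filter_upwards [hae] with u hu
        obtain ⟨i, -, rfl⟩ := Finset.mem_image.1 hu
        exact hx i
      exact ae_iff.1 hae'
    have := (quadMeasure_eq_zero_iff hS.pos measurableSet_Ici.compl).1 h0 t ht
    simpa using this
  -- The moment of order `2m + 1` is the bottom right entry of `Γ^{(1)}_m`.
  · have h := congrFun (congrFun hBW (Fin.last m)) (Fin.last m)
    rw [Matrix.mul_assoc] at h
    have hl : ∀ i, W i (Fin.last m) = x i ^ m * W i 0 := hcol m (by omega)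
    rw [Matrix.mul_apply] at h
    simp only [hankel, shift, Matrix.of_apply, Matrix.transpose_apply,
      Matrix.diagonal_mul, hl, Fin.val_last] at h
    rw [show m + m + 1 = 2 * m + 1 by ring] at h
    have h2 := hval (2 * m + 1)
    rw [hσ, integral_quadMeasure hS.pos] at h2
    rw [h, quadFun_apply]
    simp only [eval_pow, eval_X, smul_eq_mul] at h2 ⊢
    rw [h2]
    refine Finset.sum_congr rfl fun i _ => ?_
    ring

theorem map_X_mul_schurPoly_mul {m : ℕ} (hm : 1 ≤ m) (L : ℝ[X] →ₗ[ℝ] ℝ) {y : ℝ[X]}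
    (h : ∀ q : ℝ[X], q.natDegree < m → L (X * y * q) = 0) {p : ℝ[X]} (hp : p.natDegree ≤ m) :
    L (X * y * p) = p.coeff m * L (X * y * X ^ m) := by
  have hdeg : (p - C (p.coeff m) * X ^ m).natDegree < m := by
    refine natDegree_lt_of_coeff_eq_zero hm ?_ ?_
    · exact (natDegree_sub_le _ _).trans (max_le hp (natDegree_C_mul_X_pow_le _ _))
    · rw [coeff_sub, coeff_C_mul_X_pow, if_pos rfl, sub_self]
  have e : X * y * p = X * y * (p - C (p.coeff m) * X ^ m) + p.coeff m • (X * y * X ^ m) := by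
    rw [smul_eq_C_mul]; ring
  rw [e, map_add, map_smul, h _ hdeg, zero_add, smul_eq_mul]

/-- With `y` from `exists_schurPoly`, `τ = ∫ t y(t)² dσ(t)`, and the nodes are non-negative. -/
theorem IsQuadrature.param_nonneg {b : ℕ → ℝ} {m : ℕ} {S : Finset ℝ} {w : ℝ → ℝ}
    (h : IsQuadrature b m S w) (hm : 1 ≤ m) (hb : (hankel (shift b) m).PosDef)
    (hS : ∀ x ∈ S, 0 ≤ x) {τ : ℝ} (hτ : paramH b m τ = quadFun S w (X ^ (2 * m + 1))) :
    0 ≤ τ := by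
  obtain ⟨y, hy, hy1, hyL⟩ := exists_schurPoly hb
  obtain ⟨h1, h2⟩ := hyL _ h.moment
  rw [h2] at hτ
  have h4 : quadFun S w (X * y * X ^ m) = τ := by
    simp only [paramH] at hτ; linarith
  have h5 := map_X_mul_schurPoly_mul hm _ h1 hy
  rw [hy1, one_mul, h4] at h5
  rw [← h5, quadFun_apply]
  refine Finset.sum_nonneg fun x hx => mul_nonneg (h.pos x hx).le ?_
  rw [mul_assoc, eval_mul, eval_mul, eval_X]
  exact mul_nonneg (hS x hx) (mul_self_nonneg _)

/-! ### The endpoint `Λ` and the Hausdorff problem. -/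

/-- The denominator of the Nevanlinna formula in terms of the orthogonal polynomials of the shifted
sequence. -/
theorem IsQuadrature.nevPoly_eq_shift {b : ℕ → ℝ} {m : ℕ} {S : Finset ℝ} {w : ℝ → ℝ}
    (h : IsQuadrature b m S w) (hm : 1 ≤ m) (hpos : ∀ k ≤ m + 1, 0 < hankelDet b k)
    (hb : (hankel (shift b) m).PosDef) {τ : ℝ}
    (hτ : paramH b m τ = quadFun S w (X ^ (2 * m + 1))) :
    nevPoly b m (paramH b m τ) = X * (orthPoly b m -
        C (leadCoeff (shift b) (m - 1) / leadCoeff b m) * orthPoly (shift b) (m - 1)) -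
      C (leadCoeff b m * leadCoeff b m * τ) * orthPoly b m := by
  obtain ⟨y, hy, hy1, hyL⟩ := exists_schurPoly hb
  obtain ⟨h1, h2⟩ := hyL _ h.moment
  have h4 : quadFun S w (X * y * X ^ m) = τ := by
    rw [h2] at hτ
    simp only [paramH] at hτ; linarith
  have hd0 := hpos m (by omega)
  have hd1 := hpos (m + 1) (by omega)
  have hs0 : 0 < hankelDet (shift b) (m - 1) := hankelDet_pos hb (by omega)
  have hs1 : 0 < hankelDet (shift b) (m - 1 + 1) := hankelDet_pos hb (by omega)
  have hk := leadCoeff_pos hd0 hd1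
  have hk' := leadCoeff_pos hs0 hs1
  set κ := leadCoeff b m with hκ
  set κ' := leadCoeff (shift b) (m - 1) with hκ'
  set d := orthPoly b m with hd
  set d' := orthPoly (shift b) (m - 1) with hd'
  have hdd : d.natDegree ≤ m := natDegree_orthPoly_le b m
  have hdd' : d'.natDegree ≤ m - 1 := natDegree_orthPoly_le _ _
  set P := X * (d - C (κ' / κ) * d') - C (κ * κ * τ) * d with hP
  have hPd : P.natDegree ≤ m + 1 := by
    refine (natDegree_sub_le _ _).trans (max_le ?_ ?_)
    · refine (natDegree_mul_le_of_le natDegree_X_le ((natDegree_sub_le _ _).trans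
        (max_le hdd ((natDegree_C_mul_le _ _).trans (hdd'.trans (Nat.sub_le m 1)))))).trans ?_
      omega
    · exact (natDegree_C_mul_le _ _).trans (by omega)
  have hPc : P.coeff (m + 1) = κ := by
    rw [hP, coeff_sub, coeff_X_mul, coeff_sub, coeff_C_mul, coeff_C_mul, hd,
      coeff_orthPoly_self, coeff_orthPoly_of_lt b (by omega), hd',
      coeff_orthPoly_of_lt _ (by omega)]
    simp [hκ]
  -- Orthogonality together with the leading coefficient `κ` determines the polynomial, so `P` must
  -- be the denominator. Below degree `m` the two terms of `X * (d - (κ' / κ) d')` cancel; against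
  -- `y`, `d'` drops out and `L (X * y * d) = κ τ` is balanced by the last term.
  have horth : ∀ p : ℝ[X], p.natDegree ≤ m → quadFun S w (P * p) = 0 := by
    intro p hp
    refine map_mul_eq_zero_of_lt_of_eq hm _ ?_ hy (by rw [hy1]; exact one_ne_zero) ?_ hp
    · intro q hq
      have e : P * q = d * (q * X) - (κ' / κ) • (X * (d' * q)) - (κ * κ * τ) • (d * q) := by
        rw [hP, smul_eq_C_mul, smul_eq_C_mul]; ring
      have hqX : (q * X).natDegree ≤ q.natDegree + 1 :=
        natDegree_mul_le_of_le le_rfl natDegree_X_le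
      have hs := map_orthPoly_mul hs0 hs1 (mulFun (quadFun S w) X) (p := q) (by omega)
        (fun k hk => by rw [mulFun_apply, ← pow_succ', h.moment _ (by omega)]; rfl)
      rw [mulFun_apply] at hs
      rw [e, map_sub, map_sub, map_smul, map_smul, hs,
        map_orthPoly_mul hd0 hd1 _ (p := q * X) (by omega) (fun k hk => h.moment k (by omega)),
        map_orthPoly_mul hd0 hd1 _ (p := q) (by omega) (fun k hk => h.moment k (by omega)),
        coeff_eq_zero_of_natDegree_lt hq, ← hκ, ← hκ']
      obtain ⟨n, rfl⟩ : ∃ n, m = n + 1 := ⟨m - 1, by omega⟩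
      rw [coeff_mul_X, Nat.add_sub_cancel]
      simp only [smul_eq_mul]
      field_simp
      simp
    · have e : P * y = X * y * d - (κ' / κ) • (X * y * d') - (κ * κ * τ) • (d * y) := by
        rw [hP, smul_eq_C_mul, smul_eq_C_mul]; ring
      rw [e, map_sub, map_sub, map_smul, map_smul, h1 d' (by omega),
        map_X_mul_schurPoly_mul hm _ h1 hdd, h4,
        map_orthPoly_mul hd0 hd1 _ (p := y) hy (fun k hk => h.moment k (by omega)), hy1, ← hκ,
        hd, coeff_orthPoly_self, ← hκ]
      simp only [smul_eq_mul]
      field_simp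
      ring
  have hPn := h.eq_C_mul_nodal hPd fun x hx => h.eval_eq_zero horth hx
  rw [hPc] at hPn
  rw [hPn, hτ]
  exact h.nevPoly_eq (h.eval_nevPoly hm hpos)

theorem hausdorffBound_eq {b : ℕ → ℝ} {m : ℕ} (hm : 1 ≤ m) (Λ : ℝ)
    (hpos : ∀ k ≤ m + 1, 0 < hankelDet b k) (hb : (hankel (shift b) m).PosDef) :
    hausdorffBound b m Λ = Λ * (1 - leadCoeff (shift b) (m - 1) / leadCoeff b m *
      ((orthPoly (shift b) (m - 1)).eval Λ / (orthPoly b m).eval Λ)) := by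
  have hd0 := hpos m (by omega)
  have hd1 := hpos (m + 1) (by omega)
  have hs0 : 0 < hankelDet (shift b) (m - 1) := hankelDet_pos hb (by omega)
  have hs1 : 0 < hankelDet (shift b) m := hankelDet_pos hb (by omega)
  rw [hausdorffBound, leadCoeff_eq_sqrt hd0 hd1,
    leadCoeff_eq_sqrt hs0 (by rwa [Nat.sub_add_cancel hm]), Nat.sub_add_cancel hm,
    ← Real.sqrt_div (by positivity)]
  have e : hankelDet (shift b) (m - 1) / hankelDet (shift b) m /
      (hankelDet b m / hankelDet b (m + 1)) = hankelDet b (m + 1) * hankelDet (shift b) (m - 1) /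
        (hankelDet b m * hankelDet (shift b) m) := by
    field_simp
  rw [e]

/-- The value of the denominator of the Nevanlinna formula at the endpoint. -/
theorem IsQuadrature.eval_mul_bound {b : ℕ → ℝ} {m : ℕ} {S : Finset ℝ} {w : ℝ → ℝ}
    (h : IsQuadrature b m S w) (hm : 1 ≤ m) (hpos : ∀ k ≤ m + 1, 0 < hankelDet b k)
    (hb : (hankel (shift b) m).PosDef) {τ : ℝ}
    (hτ : paramH b m τ = quadFun S w (X ^ (2 * m + 1))) {Λ : ℝ}
    (hΛ : (orthPoly b m).eval Λ ≠ 0) :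
    (orthPoly b m).eval Λ * (hausdorffBound b m Λ - invEntry b m m * τ) =
      leadCoeff b m * ∏ x ∈ S, (Λ - x) := by
  have e := h.nevPoly_eq_shift hm hpos hb hτ
  rw [hτ, h.nevPoly_eq (h.eval_nevPoly hm hpos)] at e
  have e2 := congrArg (eval Λ) e
  simp only [eval_mul, eval_sub, eval_C, eval_X, Lagrange.eval_nodal, id] at e2
  rw [e2, hausdorffBound_eq hm Λ hpos hb, invEntry_eq b le_rfl (hpos m (by omega))
    (hpos (m + 1) le_rfl), coeff_orthPoly_self]
  field_simp

/-- `orthPoly b m` has no zero `z` for which the form of `z - X` is positive below degree `m`. -/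
theorem eval_orthPoly_ne_zero {b : ℕ → ℝ} {m : ℕ} (hpos : ∀ k ≤ m + 1, 0 < hankelDet b k)
    (L : ℝ[X] →ₗ[ℝ] ℝ) (hL : ∀ k ≤ 2 * m, L (X ^ k) = b k) {z : ℝ}
    (hz : ∀ g : ℝ[X], g.natDegree < m → g ≠ 0 → 0 < L ((C z - X) * (g * g))) :
    (orthPoly b m).eval z ≠ 0 := by
  intro h0
  have hk := leadCoeff_pos (hpos m (by omega)) (hpos (m + 1) le_rfl)
  have hd0 : orthPoly b m ≠ 0 := fun h => by
    have := coeff_orthPoly_self b m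
    rw [h, coeff_zero] at this
    exact hk.ne this
  -- If `d_m = (X - z) g`, then `L ((z - X) g²) = -L (d_m g) = 0` because `deg g < m`.
  obtain ⟨g, hg⟩ := dvd_iff_isRoot.2 h0
  have hg0 : g ≠ 0 := by
    rintro rfl
    exact hd0 (by rw [hg, mul_zero])
  have hgd : g.natDegree < m := by
    have h1 := natDegree_orthPoly_le b m
    rw [hg, natDegree_mul (X_sub_C_ne_zero z) hg0, natDegree_X_sub_C] at h1
    omega
  have h1 := hz g hgd hg0
  have h2 := map_orthPoly_mul (hpos m (by omega)) (hpos (m + 1) le_rfl) L hgd.le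
    (fun k hk => hL k (by omega))
  rw [coeff_eq_zero_of_natDegree_lt hgd, zero_div, hg] at h2
  rw [show (C z - X) * (g * g) = -((X - C z) * g * g) by ring, map_neg, h2, neg_zero] at h1
  exact lt_irrefl _ h1

/-- The polynomial tends to `+∞`, so a negative value at `Λ` would force a zero to the right of `Λ`.
-/
theorem eval_orthPoly_nonneg {b : ℕ → ℝ} {m : ℕ} (hm : 1 ≤ m)
    (hk : 0 < leadCoeff b m) {Λ : ℝ} (h : ∀ z, Λ < z → (orthPoly b m).eval z ≠ 0) :
    0 ≤ (orthPoly b m).eval Λ := by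
  by_contra! hneg
  have hdeg : (orthPoly b m).natDegree = m :=
    le_antisymm (natDegree_orthPoly_le b m)
      (le_natDegree_of_ne_zero (by rw [coeff_orthPoly_self]; exact hk.ne'))
  have hlim : Filter.Tendsto (fun x => (orthPoly b m).eval x) Filter.atTop Filter.atTop := by
    refine tendsto_atTop_of_leadingCoeff_nonneg _ ?_ ?_
    · exact natDegree_pos_iff_degree_pos.1 (by omega)
    · rw [leadingCoeff, hdeg, coeff_orthPoly_self]; exact hk.le
  obtain ⟨M, hM0, hMΛ⟩ :=
    ((hlim.eventually_gt_atTop 0).and (Filter.eventually_gt_atTop Λ)).exists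
  obtain ⟨z, hz, hz0⟩ := intermediate_value_Icc hMΛ.le (orthPoly b m).continuous.continuousOn
    ⟨hneg.le, hM0.le⟩
  refine h z (lt_of_le_of_ne hz.1 ?_) hz0
  rintro rfl
  exact hneg.ne hz0

theorem CondD.map_nonneg {b : ℕ → ℝ} {m : ℕ} {Λ : ℝ} (hd : CondD b m Λ)
    (L : ℝ[X] →ₗ[ℝ] ℝ) (hL : ∀ k ≤ 2 * m, L (X ^ k) = b k) {g : ℝ[X]} (hg : g.natDegree < m) :
    0 ≤ L ((C Λ - X) * (g * g)) := by
  have e : Λ • hankel b m - hankel (shift b) m = hankel (fun k => Λ * b k - b (k + 1)) m := by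
    ext i j
    simp [hankel, shift]
  rw [CondD, e] at hd
  refine map_mul_self_nonneg hd (mulFun L (C Λ - X)) (fun k hk => ?_) hg
  rw [mulFun_apply, sub_mul, map_sub, ← smul_eq_C_mul, map_smul, ← pow_succ', hL _ (by omega),
    hL _ (by omega), smul_eq_mul]

/-- For `z ≥ Λ` the form of `z - X` is strictly positive below degree `m`: a null vector `g` would
make `(X - z) g`, of degree at most `m`, vanish at all `m + 1` nodes. Hence `d_m` has no zero in
`[Λ, ∞)`. -/
theorem IsQuadrature.eval_orthPoly_pos {b : ℕ → ℝ} {m : ℕ} {S : Finset ℝ} {w : ℝ → ℝ}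
    (h : IsQuadrature b m S w) (hm : 1 ≤ m) (hpos : ∀ k ≤ m + 1, 0 < hankelDet b k) {Λ : ℝ}
    (hS : ∀ x ∈ S, x ≤ Λ) : 0 < (orthPoly b m).eval Λ := by
  have hk := leadCoeff_pos (hpos m (by omega)) (hpos (m + 1) le_rfl)
  have hne : ∀ z, Λ ≤ z → (orthPoly b m).eval z ≠ 0 := by
    intro z hz
    refine eval_orthPoly_ne_zero hpos _ h.moment fun g hg hg0 => ?_
    have hterm : ∀ x ∈ S, 0 ≤ w x * ((C z - X) * (g * g)).eval x := by
      intro x hx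
      rw [eval_mul, eval_mul, eval_sub, eval_C, eval_X]
      exact mul_nonneg (h.pos x hx).le
        (mul_nonneg (sub_nonneg.2 ((hS x hx).trans hz)) (mul_self_nonneg _))
    rw [quadFun_apply]
    refine lt_of_le_of_ne (Finset.sum_nonneg hterm) fun h0 => ?_
    have hzero := (Finset.sum_eq_zero_iff_of_nonneg hterm).1 h0.symm
    refine mul_ne_zero (X_sub_C_ne_zero z) hg0
      (eq_zero_of_natDegree_lt_card_of_eval_eq_zero' _ S (fun x hx => ?_) ?_)
    · have := hzero x hx
      simp only [eval_mul, eval_sub, eval_C, eval_X, mul_eq_zero, (h.pos x hx).ne', false_or,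
        or_self] at this ⊢
      rcases this with h1 | h1
      · left; linarith
      · right; exact h1
    · rw [natDegree_mul (X_sub_C_ne_zero z) hg0, natDegree_X_sub_C, h.card]
      omega
  exact lt_of_le_of_ne (eval_orthPoly_nonneg hm hk fun z hz => hne z hz.le) (hne Λ le_rfl).symm

/-- The nodes lie below `Λ` exactly under the bound on the parameter. -/
theorem IsQuadrature.forall_le_iff {b : ℕ → ℝ} {m : ℕ} {S : Finset ℝ} {w : ℝ → ℝ}
    (h : IsQuadrature b m S w) (hm : 1 ≤ m) (hA : (hankel b (m + 1)).PosDef)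
    (hb : (hankel (shift b) m).PosDef) {τ : ℝ}
    (hτ : paramH b m τ = quadFun S w (X ^ (2 * m + 1))) {Λ : ℝ} (hd : CondD b m Λ) :
    (∀ x ∈ S, x ≤ Λ) ↔ (orthPoly b m).eval Λ ≠ 0 ∧
      invEntry b m m * τ ≤ hausdorffBound b m Λ := by
  have hpos : ∀ k ≤ m + 1, 0 < hankelDet b k := fun k hk => hankelDet_pos hA hk
  have hk := leadCoeff_pos (hpos m (by omega)) (hpos (m + 1) le_rfl)
  constructor
  · intro hS
    have hp := h.eval_orthPoly_pos hm hpos hS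
    have e := h.eval_mul_bound hm hpos hb hτ hp.ne'
    refine ⟨hp.ne', sub_nonneg.1 (nonneg_of_mul_nonneg_right (a := (orthPoly b m).eval Λ) ?_ hp)⟩
    rw [e]
    exact mul_nonneg hk.le (Finset.prod_nonneg fun x hx => sub_nonneg.2 (hS x hx))
  · rintro ⟨hne, hle⟩ x hx
    by_contra! hlt
    -- Condition d) is only semidefinite at `Λ`; for `z > Λ` the added term `(z - Λ) L (g²)` makes
    -- the form definite and excludes zeros of `d_m` there.
    have hd0 : 0 ≤ (orthPoly b m).eval Λ := by
      refine eval_orthPoly_nonneg hm hk fun z hz => ?_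
      refine eval_orthPoly_ne_zero hpos _ h.moment fun g hg hg0 => ?_
      have h1 := hd.map_nonneg _ h.moment hg
      have h2 := map_mul_self_pos hA _ (fun k hk => h.moment k (by omega)) (p := g)
        (by omega) hg0
      have e : (C z - X) * (g * g) = (C Λ - X) * (g * g) + (z - Λ) • (g * g) := by
        rw [smul_eq_C_mul, C_sub]; ring
      rw [e, map_add, map_smul, smul_eq_mul]
      have := mul_pos (sub_pos.2 hz) h2
      linarith
    have e := h.eval_mul_bound hm hpos hb hτ hne
    have hnn : 0 ≤ leadCoeff b m * ∏ x ∈ S, (Λ - x) := by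
      rw [← e]; exact mul_nonneg hd0 (sub_nonneg.2 hle)
    refine absurd hnn (not_le.2 (mul_neg_of_pos_of_neg hk ?_))
    rw [← Finset.mul_prod_erase S _ hx]
    refine mul_neg_of_neg_of_pos (sub_neg.2 hlt) (Finset.prod_pos fun y hy => ?_)
    have hyS := Finset.mem_of_mem_erase hy
    have hyx := Finset.ne_of_mem_erase hy
    -- This test polynomial, of degree `m - 1`, sees only the nodes `x` and `y`. Condition d) then
    -- forces `y < Λ` once `x > Λ`, so exactly one factor of the product is negative.
    set g : ℝ[X] := Lagrange.nodal ((S.erase x).erase y) id with hg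
    have hgd : g.natDegree < m := by
      rw [hg, Lagrange.natDegree_nodal, Finset.card_erase_of_mem hy, Finset.card_erase_of_mem hx,
        h.card]
      omega
    have hgev : ∀ u ∈ S, u ≠ x → u ≠ y → g.eval u = 0 := fun u hu hux huy =>
      Lagrange.eval_nodal_at_node (v := id)
        (Finset.mem_erase.2 ⟨huy, Finset.mem_erase.2 ⟨hux, hu⟩⟩)
    have hgx : g.eval x ≠ 0 := by
      rw [hg, Lagrange.eval_nodal]
      refine Finset.prod_ne_zero_iff.2 fun u hu => sub_ne_zero.2 ?_
      exact (Finset.ne_of_mem_erase (Finset.mem_of_mem_erase hu)).symm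
    have h1 := hd.map_nonneg _ h.moment hgd
    rw [quadFun_apply, ← Finset.add_sum_erase S _ hx, ← Finset.add_sum_erase _ _ hy,
      Finset.sum_eq_zero (s := (S.erase x).erase y), add_zero] at h1
    · simp only [eval_mul, eval_sub, eval_C, eval_X] at h1
      have h2 : w x * ((Λ - x) * (g.eval x * g.eval x)) < 0 :=
        mul_neg_of_pos_of_neg (h.pos x hx)
          (mul_neg_of_neg_of_pos (sub_neg.2 hlt) (mul_self_pos.2 hgx))
      have h3 : 0 < w y * ((Λ - y) * (g.eval y * g.eval y)) := by linarith
      have h4 := pos_of_mul_pos_right h3 (h.pos y hyS).le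
      exact pos_of_mul_pos_left h4 (mul_self_nonneg _)
    · intro u hu
      have hu' := Finset.mem_of_mem_erase hu
      rw [eval_mul, eval_mul, hgev u (Finset.mem_of_mem_erase hu') (Finset.ne_of_mem_erase hu')
        (Finset.ne_of_mem_erase hu)]
      simp

theorem IsQuadrature.isStieltjesSolution_iff {b : ℕ → ℝ} {m : ℕ} {S : Finset ℝ} {w : ℝ → ℝ}
    (h : IsQuadrature b m S w) :
    IsStieltjesSolution b m (quadMeasure S w) ↔ ∀ x ∈ S, 0 ≤ x := by
  rw [IsStieltjesSolution, and_iff_left h.hasMoments,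
    quadMeasure_eq_zero_iff h.pos measurableSet_Ici.compl]
  simp

theorem IsQuadrature.isHausdorffSolution_iff {b : ℕ → ℝ} {m : ℕ} {S : Finset ℝ} {w : ℝ → ℝ}
    (h : IsQuadrature b m S w) (Λ : ℝ) :
    IsHausdorffSolution b m Λ (quadMeasure S w) ↔ ∀ x ∈ S, 0 ≤ x ∧ x ≤ Λ := by
  rw [IsHausdorffSolution, and_iff_left h.hasMoments,
    quadMeasure_eq_zero_iff h.pos measurableSet_Icc.compl]
  simp only [Set.mem_compl_iff, not_not, Set.mem_Icc]

end TruncatedMoment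

end

/-! ### The theorem. -/

theorem theorem3 (m : ℕ) (hm : 1 ≤ m) (b : ℕ → ℝ) (Λ : ℝ) (hΛ : 0 < Λ)
    (ha : TruncatedMoment.CondA b m) (hb : TruncatedMoment.CondB b m)
    (hc : TruncatedMoment.CondC b m) (hd : TruncatedMoment.CondD b m Λ)
    (hdet : 0 < TruncatedMoment.hankelDet b (m + 1)) :
    -- every `τ ≥ 0` gives exactly one canonical solution of the Stieltjes problem
    (∀ τ : ℝ, 0 ≤ τ → ∃! σ : MeasureTheory.Measure ℝ,
      (TruncatedMoment.IsStieltjesSolution b m σ ∧ TruncatedMoment.IsCanonical m σ) ∧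
        TruncatedMoment.NevanlinnaFormula b m (TruncatedMoment.paramH b m τ) σ) ∧
    -- every canonical solution of the Stieltjes problem comes from exactly one `τ ≥ 0`
    (∀ σ : MeasureTheory.Measure ℝ,
      TruncatedMoment.IsStieltjesSolution b m σ → TruncatedMoment.IsCanonical m σ →
        ∃! τ : ℝ, 0 ≤ τ ∧
          TruncatedMoment.NevanlinnaFormula b m (TruncatedMoment.paramH b m τ) σ) ∧
    -- which of them are canonical solutions of the Hausdorff problem
    (∀ σ : MeasureTheory.Measure ℝ, ∀ τ : ℝ,
      TruncatedMoment.IsStieltjesSolution b m σ → TruncatedMoment.IsCanonical m σ →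
      TruncatedMoment.NevanlinnaFormula b m (TruncatedMoment.paramH b m τ) σ →
        ((TruncatedMoment.IsHausdorffSolution b m Λ σ ∧ TruncatedMoment.IsCanonical m σ) ↔
          (TruncatedMoment.orthPoly b m).eval Λ ≠ 0 ∧
          0 ≤ τ ∧
          TruncatedMoment.invEntry b m m * τ ≤ TruncatedMoment.hausdorffBound b m Λ)) := by
  have hA : (TruncatedMoment.hankel b (m + 1)).PosDef := ha.posDef_iff_det_ne_zero.2 hdet.ne'
  have hB := hc.posDef hm hA
  have hpos : ∀ k ≤ m + 1, 0 < TruncatedMoment.hankelDet b k := fun k hk =>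
    TruncatedMoment.hankelDet_pos hA hk
  refine ⟨fun τ hτ => ?_, fun σ hσ hcan => ?_, fun σ τ hσ hcan hN => ?_⟩
  -- The parameter prescribes one further moment, of order `2m + 1`; `Γ_m` does not contain it,
  -- while `Γ^{(1)}_m` has it as its corner entry.
  · set b' := Function.update b (2 * m + 1) (TruncatedMoment.paramH b m τ) with hb'
    have hbb' : ∀ k ≤ 2 * m, b' k = b k := fun k hk => Function.update_of_ne (by omega) _ _
    have hA' : TruncatedMoment.hankel b' (m + 1) = TruncatedMoment.hankel b (m + 1) := by
      ext i j
      exact hbb' _ (by omega)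
    obtain ⟨S, w, hS, hS0, hcan, hH⟩ := TruncatedMoment.exists_canonical_of_posSemidef
      (hA'.symm ▸ hA) (TruncatedMoment.posSemidef_shift_update hm hB hτ)
    have hS' : TruncatedMoment.IsQuadrature b m S w :=
      ⟨hS.card, hS.pos, fun k hk => (hS.moment k hk).trans (hbb' k hk)⟩
    rw [Function.update_self] at hH
    refine ⟨TruncatedMoment.quadMeasure S w, ⟨⟨hS'.isStieltjesSolution_iff.2 hS0, hcan⟩,
      (hS'.nevanlinnaFormula_iff hm hpos _).2 hH.symm⟩, ?_⟩
    rintro σ ⟨⟨hσ, hσc⟩, hN⟩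
    obtain ⟨S₁, w₁, hS₁, rfl⟩ := hσc.exists_quadrature hA hσ.2
    exact hS₁.quadMeasure_eq hS' hm hpos
      (((hS₁.nevanlinnaFormula_iff hm hpos _).1 hN).symm.trans hH.symm)
  · obtain ⟨S, w, hS, rfl⟩ := hcan.exists_quadrature hA hσ.2
    -- `H` is `τ` plus a constant, so every value of the next moment comes from exactly one `τ`.
    obtain ⟨τ, hτ⟩ : ∃ τ, TruncatedMoment.paramH b m τ =
        TruncatedMoment.quadFun S w (X ^ (2 * m + 1)) :=
      ⟨_, sub_add_cancel _ _⟩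
    refine ⟨τ, ⟨hS.param_nonneg hm hB (hS.isStieltjesSolution_iff.1 hσ) hτ,
      (hS.nevanlinnaFormula_iff hm hpos _).2 hτ⟩, ?_⟩
    rintro τ' ⟨-, hτ'⟩
    have h := ((hS.nevanlinnaFormula_iff hm hpos _).1 hτ').trans hτ.symm
    exact add_right_cancel h
  · obtain ⟨S, w, hS, rfl⟩ := hcan.exists_quadrature hA hσ.2
    have hS0 := hS.isStieltjesSolution_iff.1 hσ
    have hτ := (hS.nevanlinnaFormula_iff hm hpos _).1 hN
    have hiff := hS.forall_le_iff hm hA hB hτ hd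
    rw [and_iff_left hcan, hS.isHausdorffSolution_iff,
      and_iff_right (hS.param_nonneg hm hB hS0 hτ), ← hiff]
    exact forall₂_congr fun x hx => and_iff_right (hS0 x hx)
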